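/- Theorem 4 (Multinomial Logistic Model). Let $K\ge 1$, let $X$ be a random element of $L^1[0,1]$ with law $G$ such that $\|X\|_1=\int_0^1|X(t)|\,dt$ is bounded almost surely, and for coefficient functions $\beta=(\beta_1,\dots,\beta_{K-1})$ on $[0,1]$ put $$\pi_{\beta,k}(X)=\frac{\exp[\int\beta_k(t)X(t)\,dt]}{1+\sum_{l=1}^{K-1}\exp[\int\beta_l(t)X(t)\,dt]}\ (1\le k\le K-1),\qquad \pi_{\beta,K}(X)=\frac{1}{1+\sum_{l=1}^{K-1}\exp[\int\beta_l(t)X(t)\,dt]}.$$ Let $(X_i,Y_i)$, $i=1,\dots,n$, be i.i.d. with $X_i\sim G$ and $P(Y_i=k\mid X_i)=\pi_{0k}(X_i):=\pi_{\beta_0,k}(X_i)$ for true coefficient functions $\beta_0=(\beta_{01},\dots,\beta_{0,K-1})$. For every $J\ge 1$ let $\psi=\psi_J=(\psi_{J,1},\dots,\psi_{J,J})$ be measurable functions on $[0,1]$. The prior on $\beta$ draws $J$ from a law $\Pi$ on the nonnegative integers and then, given $J$, independent vectors $\theta_1,\dots,\theta_{K-1}\in\mathbb R^J$, and sets $\beta_k=\theta_k^T\psi_J$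 (zero if $J=0$). Suppose that there are constants $\alpha>0$, $K_0\ge 0$, $H$ such that the following hold. (A1) For some $c_1,c_2>0$ and $0\le t_2\le t_1\le 1$, $\exp\{-c_1 j\log^{t_1}j\}\le\Pi(J=j)\le\exp\{-c_2 j\log^{t_2}j\}$ for all sufficiently large $j$. (A2) For each $k$, with constants independent of $J\ge1$: there are $c_3,\varepsilon_0>0$ and $b\ge0$ such that $\Pi(\|\theta_k-\vartheta\|_2\le\epsilon\mid J)\ge\exp\{-c_3J\log(1/\epsilon)\}$ whenever $\|\vartheta\|_\infty\le H$ and $0<\epsilon\le\varepsilon_0J^{-b}$; and there are $C,t_3>0$ such that $\Pi(\theta_k\notin[-M,M]^J\mid J)\le J\exp\{-CM^{t_3}\}$ for all sufficiently large $M$. (5.10) For each $k$ there is a constant $C'>0$ such that for every $J\ge1$ there is $\vartheta\in\mathbb R^J$ with $\|\vartheta\|_\infty\le H$ and $\sup_t|\beta_{0k}(t)-\vartheta^T\psi_J(t)|\le C'J^{-\alpha}$. (5.11) There is a constant $C''>0$ such that $\sup_t|\vartheta_1^T\psi_J(t)-\vartheta_2^T\psi_J(t)|\le C''J^{K_0}\|\vartheta_1-\vartheta_2\|_2$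 for all $J\ge1$ and $\vartheta_1,\vartheta_2\in\mathbb R^J$. Then the posterior contracts at every rate $\epsilon_n>0$ with $\epsilon_n\asymp n^{-\alpha/(2\alpha+1)}(\log n)^{\alpha/(2\alpha+1)+(1-t_2)/2}$ relative to $$d(\pi,\pi_0)=\Big(\sum_{k=1}^K E_X|\pi_k(X)-\pi_{0k}(X)|^2\Big)^{1/2};$$ that is, for every $M_n\to\infty$, the posterior probability $\Pi\big(\beta: d(\pi_\beta,\pi_0)\ge M_n\epsilon_n\mid (X_1,Y_1),\dots,(X_n,Y_n)\big)$ tends to $0$ in probability under the true law of the data. -/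

import Mathlib

open MeasureTheory Filter Topology

/-- A functional covariate: an integrable function on the unit interval (up to null sets).
Its norm is `∫ |x(t)| dt`. -/
abbrev Covariate : Type := Lp ℝ 1 (volume : Measure unitInterval)

noncomputable instance Covariate.instMeasurableSpace : MeasurableSpace Covariate := borel Covariate

instance Covariate.instBorelSpace : BorelSpace Covariate := ⟨rfl⟩

/-- The inner product `∫ β(t) x(t) dt` of a coefficient function with a covariate. -/
noncomputable def linearPredictor (β : unitInterval → ℝ) (x : Covariate) : ℝ :=
  ∫ t, β t * x t

/-- The category probabilities of the multinomial logistic model with `K = m + 1` categories and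
coefficient functions `β 0, …, β (m - 1)`; the last category is the reference category, whose
coefficient function is zero. -/
noncomputable def categoryProb {m : ℕ} (β : Fin m → unitInterval → ℝ) (x : Covariate) :
    Fin (m + 1) → ℝ :=
  Fin.lastCases
    (1 / (1 + ∑ l, Real.exp (linearPredictor (β l) x)))
    (fun k => Real.exp (linearPredictor (β k) x) /
      (1 + ∑ l, Real.exp (linearPredictor (β l) x)))

/-- The distance `d(π, π₀) = (∑ₖ E |πₖ(X) - π₀ₖ(X)|²)^{1/2}` between the category probabilities
given by two vectors of coefficient functions, where `X` has law `G`. -/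
noncomputable def probDist {m : ℕ} (G : Measure Covariate) (β β₀ : Fin m → unitInterval → ℝ) : ℝ :=
  Real.sqrt (∑ k, ∫ x, |categoryProb β x k - categoryProb β₀ x k| ^ 2 ∂G)

/-- The joint law of one observation `(X, Y)`: `X` has law `G`, and given `X` the category `Y` has
the logistic probabilities with coefficient functions `β`. -/
noncomputable def observationLaw {m : ℕ} (G : Measure Covariate)
    (β : Fin m → unitInterval → ℝ) : Measure (Covariate × Fin (m + 1)) :=
  (G.prod Measure.count).withDensity fun z => ENNReal.ofReal (categoryProb β z.1 z.2)

/-- The joint law of `n` independent observations. -/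
noncomputable def sampleLaw {m : ℕ} (G : Measure Covariate)
    (β : Fin m → unitInterval → ℝ) (n : ℕ) : Measure (Fin n → Covariate × Fin (m + 1)) :=
  Measure.pi fun _ => observationLaw G β

/-- The function `θᵀψ` on the unit interval, for basis functions `ψ 0, …, ψ (J - 1)`. -/
noncomputable def series {J : ℕ} (ψ : Fin J → unitInterval → ℝ) (θ : EuclideanSpace ℝ (Fin J)) :
    unitInterval → ℝ :=
  fun t => ∑ j, θ j * ψ j t

/-- The parameters of a finite random series: the number `J` of basis functions, and for each of
the `m` coefficient functions a coefficient vector in `ℝ^J`. -/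
abbrev SeriesParam (m : ℕ) : Type := Σ J : ℕ, Fin m → EuclideanSpace ℝ (Fin J)

/-- The coefficient functions that belong to a parameter. -/
noncomputable def SeriesParam.coeff {m : ℕ} (ψ : (J : ℕ) → Fin J → unitInterval → ℝ)
    (s : SeriesParam m) : Fin m → unitInterval → ℝ :=
  fun k => series (ψ s.1) (s.2 k)

/-- The finite random series prior: `J` is drawn from `p`, and given `J` the coefficient vectors
`θ₁, …, θ_m` are independent with laws `Q J 0, …, Q J (m - 1)`. -/
noncomputable def seriesPrior {m : ℕ} (p : PMF ℕ)
    (Q : (J : ℕ) → Fin m → Measure (EuclideanSpace ℝ (Fin J))) : Measure (SeriesParam m) :=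
  Measure.sum fun J => p J • (Measure.pi (Q J)).map (Sigma.mk J)

/-- The likelihood of the data `z = (xᵢ, yᵢ)ᵢ` at the coefficient functions `β`. -/
noncomputable def likelihood {m n : ℕ} (β : Fin m → unitInterval → ℝ)
    (z : Fin n → Covariate × Fin (m + 1)) : ENNReal :=
  ∏ i, ENNReal.ofReal (categoryProb β (z i).1 (z i).2)

/-- The posterior probability, by the Bayes formula, that the parameter lies in `B`, given the
data `z`. The denominator lies in `(0, 1]` for every probability measure `prior`. -/
noncomputable def posterior {m n : ℕ} (ψ : (J : ℕ) → Fin J → unitInterval → ℝ)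
    (prior : Measure (SeriesParam m)) (z : Fin n → Covariate × Fin (m + 1))
    (B : Set (SeriesParam m)) : ENNReal :=
  (∫⁻ s in B, likelihood (s.coeff ψ) z ∂prior) / ∫⁻ s, likelihood (s.coeff ψ) z ∂prior

/-- The condition on the prior of the number of basis functions:
`exp (-c₁ j log^{t₁} j) ≤ p(j) ≤ exp (-c₂ j log^{t₂} j)`.
It is asked for all large `j`; at `j = 1` the lower bound would read `p(1) = 1` if `t₁ > 0`. -/
def DimensionPriorCondition (p : PMF ℕ) (t₁ t₂ : ℝ) : Prop :=
  0 ≤ t₂ ∧ t₂ ≤ t₁ ∧ t₁ ≤ 1 ∧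
    ∃ c₁ > 0, ∃ c₂ > 0, ∀ᶠ j : ℕ in atTop,
      Real.exp (-c₁ * j * Real.log j ^ t₁) ≤ (p j).toReal ∧
      (p j).toReal ≤ Real.exp (-c₂ * j * Real.log j ^ t₂)

/-- The condition on the prior of a coefficient vector given `J`, with constants that do not depend
on `J`: small balls around every `θ₀` in the cube `[-H, H]^J` have mass at least
`exp (-c₃ J log (1/ε))`, and the complement of `[-M, M]^J` has mass at most `J exp (-C M^{t₃})` for
large `M`. The threshold below which `ε` counts as small may decrease polynomially in `J`: no
sequence of laws satisfies the lower bound with a threshold that is the same for all `J`, because a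
fixed cube contains more than `J^{J/4}` disjoint balls of a fixed small radius when `J` is large. -/
def CoefficientPriorCondition (Q : (J : ℕ) → Measure (EuclideanSpace ℝ (Fin J))) (H : ℝ) : Prop :=
  (∃ c₃ > 0, ∃ ε₀ > 0, ∃ b ≥ (0 : ℝ), ∀ J : ℕ, 1 ≤ J →
    ∀ θ₀ : EuclideanSpace ℝ (Fin J), (∀ j, |θ₀ j| ≤ H) →
    ∀ ε : ℝ, 0 < ε → ε ≤ ε₀ * (J : ℝ) ^ (-b) →
      Real.exp (-c₃ * J * Real.log (1 / ε)) ≤ (Q J).real {θ | ‖θ - θ₀‖ ≤ ε}) ∧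
  (∃ C > 0, ∃ t₃ > 0, ∀ᶠ M : ℝ in atTop, ∀ J : ℕ, 1 ≤ J →
    (Q J).real {θ | ¬ ∀ j, θ j ∈ Set.Icc (-M) M} ≤ J * Real.exp (-C * M ^ t₃))

/-- Approximation of `β₀` in supremum norm at rate `J^{-α}` by series whose coefficients are
bounded by `H`. -/
def ApproximationCondition (ψ : (J : ℕ) → Fin J → unitInterval → ℝ) (β₀ : unitInterval → ℝ)
    (H α : ℝ) : Prop :=
  ∃ C > 0, ∀ J : ℕ, 1 ≤ J → ∃ θ₀ : EuclideanSpace ℝ (Fin J), (∀ j, |θ₀ j| ≤ H) ∧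
    ∀ t, |β₀ t - series (ψ J) θ₀ t| ≤ C * (J : ℝ) ^ (-α)

/-- The supremum distance of two series is at most a constant times `J^{K₀}` times the Euclidean
distance of their coefficient vectors. -/
def BasisLipschitzCondition (ψ : (J : ℕ) → Fin J → unitInterval → ℝ) (K₀ : ℝ) : Prop :=
  ∃ C > 0, ∀ J : ℕ, 1 ≤ J → ∀ θ₁ θ₂ : EuclideanSpace ℝ (Fin J),
    ∀ t, |series (ψ J) θ₁ t - series (ψ J) θ₂ t| ≤ C * (J : ℝ) ^ K₀ * ‖θ₁ - θ₂‖

/-- Posterior contraction at rate `ε` around `β₀` in the distance `probDist G`: for every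
`Mₙ → ∞`, the posterior probability of `{d(π, π₀) ≥ Mₙ εₙ}` tends to zero in probability under the
law of `n` independent observations from `β₀`. -/
def PosteriorContractsAtRate {m : ℕ} (G : Measure Covariate)
    (ψ : (J : ℕ) → Fin J → unitInterval → ℝ) (prior : Measure (SeriesParam m))
    (β₀ : Fin m → unitInterval → ℝ) (ε : ℕ → ℝ) : Prop :=
  ∀ M : ℕ → ℝ, Tendsto M atTop atTop → ∀ δ : ENNReal, 0 < δ →
    Tendsto (fun n : ℕ => sampleLaw G β₀ n
        {z | δ ≤ posterior ψ prior z {s | M n * ε n ≤ probDist G (s.coeff ψ) β₀}})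
      atTop (𝓝 0)

/-! Write the posterior as a quotient of integrals of the likelihood ratio to `β₀`, and put
`r = α / (2 α + 1)` and `T = n ^ (1 - 2 r) * (log n) ^ (2 r)`.

The denominator is at least `exp (-κ T)` with high probability: if it were small, then by
Cauchy–Schwarz the inverse likelihood ratio would be large on average over a sup-norm neighborhood
of `β₀`, whereas its mean there is controlled by the chi-squared divergence. Taking about
`(n / log n) ^ (1 / (2 α + 1))` basis functions, which balances `n J ^ (-2 α)` against `J log J`,
gives such a neighborhood with radius of order `(T / n) ^ (1 / 2)` and prior mass `exp (-O(T))`.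

For the numerator, the sieve of parameters with at most a multiple of
`n ^ (1 - 2 r) * (log n) ^ (2 r - t₂)` basis functions and polynomially bounded coefficients misses
prior mass `o(exp (-c T))`. On the sieve no tests are needed: the square root of the likelihood
ratio has mean at most `exp (-n d² / 8)`, and the sieve has a sup-norm cover, of log-cardinality
`O(n ε²)`, on each of whose cells the likelihood varies by at most a factor `e`. -/

open scoped ENNReal

open Real (exp log)

open ENNReal (ofReal)

section ProbabilityVector

variable {ι : Type*} [Fintype ι] {p q : ι → ℝ}

lemma sqrt_mul_le_half_add_sub {a b : ℝ} (ha : 0 ≤ a) (hb : 0 ≤ b) (ha1 : a ≤ 1) (hb1 : b ≤ 1) :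
    √(a * b) ≤ (a + b) / 2 - |a - b| ^ 2 / 8 := by
  obtain ⟨u, hu, rfl⟩ : ∃ u, 0 ≤ u ∧ a = u ^ 2 := ⟨√a, Real.sqrt_nonneg _, (Real.sq_sqrt ha).symm⟩
  obtain ⟨v, hv, rfl⟩ : ∃ v, 0 ≤ v ∧ b = v ^ 2 := ⟨√b, Real.sqrt_nonneg _, (Real.sq_sqrt hb).symm⟩
  have hu1 : u ≤ 1 := (sq_le_one_iff₀ hu).1 ha1
  have hv1 : v ≤ 1 := (sq_le_one_iff₀ hv).1 hb1
  have hsum : (u + v) ^ 2 ≤ 4 := by nlinarith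
  rw [← mul_pow, Real.sqrt_sq (mul_nonneg hu hv), sq_abs]
  nlinarith [mul_le_mul_of_nonneg_left hsum (sq_nonneg (u - v))]

lemma sum_mul_sqrt_div_le (hp : ∀ k, 0 < p k) (hq : ∀ k, 0 < q k) (hp1 : ∑ k, p k = 1)
    (hq1 : ∑ k, q k = 1) :
    ∑ k, q k * √(p k / q k) ≤ 1 - (∑ k, |p k - q k| ^ 2) / 8 := by
  have le_one {r : ι → ℝ} (hr : ∀ k, 0 < r k) (hr1 : ∑ k, r k = 1) (k : ι) : r k ≤ 1 :=
    hr1 ▸ Finset.single_le_sum (fun i _ => (hr i).le) (Finset.mem_univ k)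
  calc ∑ k, q k * √(p k / q k)
      = ∑ k, √(p k * q k) := Finset.sum_congr rfl fun k _ => by
        have h : p k * q k = q k ^ 2 * (p k / q k) := by field_simp [(hq k).ne']
        rw [h, Real.sqrt_mul (sq_nonneg _), Real.sqrt_sq (hq k).le]
    _ ≤ ∑ k, ((p k + q k) / 2 - |p k - q k| ^ 2 / 8) := Finset.sum_le_sum fun k _ =>
        sqrt_mul_le_half_add_sub (hp k).le (hq k).le (le_one hp hp1 k) (le_one hq hq1 k)
    _ = 1 - (∑ k, |p k - q k| ^ 2) / 8 := by
        rw [Finset.sum_sub_distrib, ← Finset.sum_div, ← Finset.sum_div, Finset.sum_add_distrib,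
          hp1, hq1]
        norm_num

lemma abs_sub_one_le_of_le_exp {r t : ℝ} (ht : t ≤ 1) (hr : exp (-t) ≤ r) (hr' : r ≤ exp t) :
    |r - 1| ≤ 2 * t := by
  have ht0 : 0 ≤ t := by linarith [Real.exp_le_exp.1 (hr.trans hr')]
  have hupper := Real.abs_exp_sub_one_le (x := t) (by rwa [abs_of_nonneg ht0])
  have hlower := Real.abs_exp_sub_one_le (x := -t) (by rwa [abs_neg, abs_of_nonneg ht0])
  rw [abs_of_nonneg ht0, abs_le] at hupper
  rw [abs_neg, abs_of_nonneg ht0, abs_le] at hlower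
  rw [abs_le]
  constructor <;> linarith

-- The left-hand side is one plus the chi-squared divergence of `q` from `p`.
lemma sum_mul_div_le_exp (hp : ∀ k, 0 < p k) (hp1 : ∑ k, p k = 1) (hq1 : ∑ k, q k = 1) {t : ℝ}
    (ht : t ≤ 1) (hpq : ∀ k, p k ≤ exp t * q k) (hqp : ∀ k, q k ≤ exp t * p k) :
    ∑ k, q k * (q k / p k) ≤ exp (4 * t ^ 2) := by
  have ratio_sub_one_sq (k : ι) : (q k / p k - 1) ^ 2 ≤ 4 * t ^ 2 := by
    have h : |q k / p k - 1| ≤ 2 * t := by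
      refine abs_sub_one_le_of_le_exp ht ?_ ((div_le_iff₀ (hp k)).2 (hqp k))
      rw [le_div_iff₀ (hp k), Real.exp_neg, inv_mul_le_iff₀ (Real.exp_pos t)]
      exact hpq k
    calc (q k / p k - 1) ^ 2 ≤ (2 * t) ^ 2 := sq_le_sq' (abs_le.1 h).1 (abs_le.1 h).2
      _ = 4 * t ^ 2 := by ring
  calc ∑ k, q k * (q k / p k)
      = ∑ k, (2 * q k - p k + p k * (q k / p k - 1) ^ 2) := Finset.sum_congr rfl fun k _ => by
        field_simp [(hp k).ne']
        ring
    _ ≤ ∑ k, (2 * q k - p k + p k * (4 * t ^ 2)) := Finset.sum_le_sum fun k _ => by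
        gcongr
        · exact (hp k).le
        · exact ratio_sub_one_sq k
    _ = 4 * t ^ 2 + 1 := by
        rw [Finset.sum_add_distrib, Finset.sum_sub_distrib, ← Finset.mul_sum, ← Finset.sum_mul,
          hp1, hq1]
        ring
    _ ≤ exp (4 * t ^ 2) := Real.add_one_le_exp _

end ProbabilityVector

/-- Measurable and bounded coefficient functions, for which `linearPredictor` is a genuine integral
at every covariate. -/
def BoundedMeasurable (β : unitInterval → ℝ) : Prop :=
  Measurable β ∧ ∃ B, ∀ t, |β t| ≤ B

lemma BoundedMeasurable.integrable_mul {β : unitInterval → ℝ} (hβ : BoundedMeasurable β)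
    (x : Covariate) : Integrable fun t => β t * x t :=
  (L1.integrable_coeFn x).bdd_mul hβ.1.aestronglyMeasurable (Eventually.of_forall hβ.2.choose_spec)

section LinearPredictor

variable {β γ : unitInterval → ℝ}

lemma abs_linearPredictor_le {B : ℝ} (hB : ∀ t, |β t| ≤ B) (x : Covariate) :
    |linearPredictor β x| ≤ B * ‖x‖ := by
  rw [L1.norm_eq_integral_norm, ← integral_const_mul, ← Real.norm_eq_abs]
  refine norm_integral_le_of_norm_le ((L1.integrable_coeFn x).norm.const_mul B)
    (Eventually.of_forall fun t => ?_)
  rw [norm_mul]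
  exact mul_le_mul_of_nonneg_right (hB t) (norm_nonneg _)

lemma abs_linearPredictor_sub_le (hβ : BoundedMeasurable β) (hγ : BoundedMeasurable γ) {η : ℝ}
    (h : ∀ t, |β t - γ t| ≤ η) (x : Covariate) :
    |linearPredictor β x - linearPredictor γ x| ≤ η * ‖x‖ := by
  have hsub : linearPredictor β x - linearPredictor γ x =
      linearPredictor (fun t => β t - γ t) x := by
    simp only [linearPredictor, sub_mul]
    exact (integral_sub (hβ.integrable_mul x) (hγ.integrable_mul x)).symm
  rw [hsub]
  exact abs_linearPredictor_le h x

lemma linearPredictor_sub_right (hβ : BoundedMeasurable β) (x y : Covariate) :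
    linearPredictor β (x - y) = linearPredictor β x - linearPredictor β y := by
  simp only [linearPredictor]
  rw [← integral_sub (hβ.integrable_mul x) (hβ.integrable_mul y)]
  refine integral_congr_ae ?_
  filter_upwards [Lp.coeFn_sub x y] with t ht
  rw [ht, Pi.sub_apply, mul_sub]

lemma continuous_linearPredictor (hβ : BoundedMeasurable β) : Continuous (linearPredictor β) := by
  obtain ⟨B, hB⟩ := hβ.2
  have hB0 : 0 ≤ B := (abs_nonneg _).trans (hB 0)
  refine (LipschitzWith.of_dist_le_mul (K := ⟨B, hB0⟩) fun x y => ?_).continuous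
  rw [Real.dist_eq, ← linearPredictor_sub_right hβ, dist_eq_norm]
  exact abs_linearPredictor_le hB (x - y)

end LinearPredictor

section CategoryProb

variable {m : ℕ} (β γ : Fin m → unitInterval → ℝ) (x : Covariate)

lemma one_add_sum_exp_pos : 0 < 1 + ∑ l, exp (linearPredictor (β l) x) :=
  add_pos_of_pos_of_nonneg one_pos (Finset.sum_nonneg fun _ _ => (Real.exp_pos _).le)

lemma categoryProb_pos (k : Fin (m + 1)) : 0 < categoryProb β x k := by
  have h := one_add_sum_exp_pos β x
  induction k using Fin.lastCases with
  | last => simp only [categoryProb, Fin.lastCases_last]; positivity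
  | cast k => simp only [categoryProb, Fin.lastCases_castSucc]; positivity

lemma sum_categoryProb : ∑ k, categoryProb β x k = 1 := by
  rw [Fin.sum_univ_castSucc]
  simp only [categoryProb, Fin.lastCases_last, Fin.lastCases_castSucc]
  rw [← Finset.sum_div, ← add_div, add_comm, div_self (one_add_sum_exp_pos β x).ne']

lemma categoryProb_le_one (k : Fin (m + 1)) : categoryProb β x k ≤ 1 :=
  sum_categoryProb β x ▸
    Finset.single_le_sum (fun i _ => (categoryProb_pos β x i).le) (Finset.mem_univ k)

variable {β γ x}

lemma categoryProb_le_exp_mul {δ : ℝ} (hδ : 0 ≤ δ)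
    (h : ∀ l, |linearPredictor (β l) x - linearPredictor (γ l) x| ≤ δ) (k : Fin (m + 1)) :
    categoryProb β x k ≤ exp (2 * δ) * categoryProb γ x k := by
  have exp_le {a b : ℝ} (hab : |a - b| ≤ δ) : exp a ≤ exp δ * exp b := by
    rw [← Real.exp_add]
    exact Real.exp_le_exp.2 (by linarith [(abs_le.1 hab).2])
  have hden : 1 + ∑ l, exp (linearPredictor (γ l) x) ≤
      exp δ * (1 + ∑ l, exp (linearPredictor (β l) x)) := by
    rw [mul_add, Finset.mul_sum, mul_one]
    exact add_le_add (Real.one_le_exp hδ)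
      (Finset.sum_le_sum fun l _ => exp_le (abs_sub_comm (linearPredictor (β l) x) _ ▸ h l))
  have hquot {a b : ℝ} (hb : 0 ≤ b) (hab : a ≤ exp δ * b) :
      a / (1 + ∑ l, exp (linearPredictor (β l) x)) ≤
        exp (2 * δ) * (b / (1 + ∑ l, exp (linearPredictor (γ l) x))) := by
    rw [← mul_div_assoc, div_le_div_iff₀ (one_add_sum_exp_pos β x) (one_add_sum_exp_pos γ x)]
    calc a * (1 + ∑ l, exp (linearPredictor (γ l) x))
        ≤ (exp δ * b) * (exp δ * (1 + ∑ l, exp (linearPredictor (β l) x))) :=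
          mul_le_mul hab hden (one_add_sum_exp_pos γ x).le (by positivity)
      _ = exp (2 * δ) * b * (1 + ∑ l, exp (linearPredictor (β l) x)) := by
          rw [two_mul, Real.exp_add]; ring
  induction k using Fin.lastCases with
  | last =>
    simp only [categoryProb, Fin.lastCases_last]
    exact hquot zero_le_one (by rw [mul_one]; exact Real.one_le_exp hδ)
  | cast k =>
    simp only [categoryProb, Fin.lastCases_castSucc]
    exact hquot (Real.exp_pos _).le (exp_le (h k))

lemma measurable_categoryProb_of_linearPredictor {Ω : Type*} [MeasurableSpace Ω]
    {b : Ω → Fin m → unitInterval → ℝ} {X : Ω → Covariate}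
    (h : ∀ l, Measurable fun ω => linearPredictor (b ω l) (X ω)) (k : Fin (m + 1)) :
    Measurable fun ω => categoryProb (b ω) (X ω) k := by
  induction k using Fin.lastCases with
  | last => simp only [categoryProb, Fin.lastCases_last]; fun_prop
  | cast k =>
    simp only [categoryProb, Fin.lastCases_castSucc]
    have := h k
    fun_prop

lemma measurable_categoryProb (hβ : ∀ l, BoundedMeasurable (β l)) (k : Fin (m + 1)) :
    Measurable fun x => categoryProb β x k :=
  measurable_categoryProb_of_linearPredictor (b := fun _ => β) (X := id)
    (fun l => (continuous_linearPredictor (hβ l)).measurable) k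

lemma measurable_categoryProb_uncurry (hβ : ∀ l, BoundedMeasurable (β l)) :
    Measurable fun z : Covariate × Fin (m + 1) => categoryProb β z.1 z.2 :=
  measurable_from_prod_countable_left fun k => measurable_categoryProb hβ k

end CategoryProb

section ProbDist

variable {m : ℕ} {G : Measure Covariate} {β γ : Fin m → unitInterval → ℝ}

lemma integrable_abs_categoryProb_sub_sq [IsFiniteMeasure G]
    (hβ : ∀ l, BoundedMeasurable (β l)) (hγ : ∀ l, BoundedMeasurable (γ l)) (k : Fin (m + 1)) :
    Integrable (fun x => |categoryProb β x k - categoryProb γ x k| ^ 2) G := by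
  have hmeas := (measurable_categoryProb hβ k).sub (measurable_categoryProb hγ k)
  refine Integrable.of_bound (C := 1) (hmeas.abs.pow_const 2).aestronglyMeasurable
    (Eventually.of_forall fun x => ?_)
  rw [Real.norm_of_nonneg (by positivity)]
  refine pow_le_one₀ (abs_nonneg _) (abs_le.2 ⟨?_, ?_⟩)
  · linarith [categoryProb_pos β x k, categoryProb_le_one γ x k]
  · linarith [categoryProb_pos γ x k, categoryProb_le_one β x k]

lemma probDist_sq :
    probDist G β γ ^ 2 = ∑ k, ∫ x, |categoryProb β x k - categoryProb γ x k| ^ 2 ∂G :=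
  Real.sq_sqrt (Finset.sum_nonneg fun _ _ => integral_nonneg fun _ => by positivity)

end ProbDist

section ObservationLaw

variable {m : ℕ} {G : Measure Covariate} {β γ : Fin m → unitInterval → ℝ}

lemma lintegral_observationLaw (hγ : ∀ l, BoundedMeasurable (γ l))
    {f : Covariate × Fin (m + 1) → ℝ≥0∞} (hf : Measurable f) :
    ∫⁻ z, f z ∂(observationLaw G γ) = ∫⁻ x, ∑ k, ofReal (categoryProb γ x k) * f (x, k) ∂G := by
  have hdensity := (measurable_categoryProb_uncurry hγ).ennreal_ofReal
  rw [observationLaw, lintegral_withDensity_eq_lintegral_mul _ hdensity hf,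
    lintegral_prod _ (hdensity.mul hf).aemeasurable]
  simp only [Pi.mul_apply, lintegral_count, tsum_fintype]

lemma lintegral_ofReal_observationLaw (hγ : ∀ l, BoundedMeasurable (γ l))
    {g : Covariate × Fin (m + 1) → ℝ} (hg : Measurable g) (hg0 : ∀ z, 0 ≤ g z) :
    ∫⁻ z, ofReal (g z) ∂(observationLaw G γ) =
      ∫⁻ x, ofReal (∑ k, categoryProb γ x k * g (x, k)) ∂G := by
  rw [lintegral_observationLaw hγ hg.ennreal_ofReal]
  refine lintegral_congr fun x => ?_
  rw [ENNReal.ofReal_sum_of_nonneg fun k _ => mul_nonneg (categoryProb_pos γ x k).le (hg0 _)]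
  exact Finset.sum_congr rfl fun k _ => (ENNReal.ofReal_mul (categoryProb_pos γ x k).le).symm

lemma isProbabilityMeasure_observationLaw [IsProbabilityMeasure G]
    (hγ : ∀ l, BoundedMeasurable (γ l)) : IsProbabilityMeasure (observationLaw G γ) where
  measure_univ := by
    simpa [sum_categoryProb] using lintegral_ofReal_observationLaw (G := G) hγ (g := fun _ => 1)
      measurable_const fun _ => zero_le_one

/-- The likelihood ratio of two vectors of coefficient functions for one observation. It is never
a junk value, since `categoryProb` is strictly positive. -/
noncomputable def likelihoodRatio (β γ : Fin m → unitInterval → ℝ)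
    (z : Covariate × Fin (m + 1)) : ℝ :=
  categoryProb β z.1 z.2 / categoryProb γ z.1 z.2

lemma likelihoodRatio_pos (z : Covariate × Fin (m + 1)) : 0 < likelihoodRatio β γ z :=
  div_pos (categoryProb_pos _ _ _) (categoryProb_pos _ _ _)

lemma measurable_likelihoodRatio (hβ : ∀ l, BoundedMeasurable (β l))
    (hγ : ∀ l, BoundedMeasurable (γ l)) : Measurable (likelihoodRatio β γ) :=
  (measurable_categoryProb_uncurry hβ).div (measurable_categoryProb_uncurry hγ)

variable [IsProbabilityMeasure G]

lemma lintegral_likelihoodRatio (hβ : ∀ l, BoundedMeasurable (β l))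
    (hγ : ∀ l, BoundedMeasurable (γ l)) :
    ∫⁻ z, ofReal (likelihoodRatio β γ z) ∂(observationLaw G γ) = 1 := by
  rw [lintegral_ofReal_observationLaw hγ (measurable_likelihoodRatio hβ hγ)
    fun z => (likelihoodRatio_pos z).le]
  simp [likelihoodRatio, mul_div_cancel₀ _ (categoryProb_pos γ _ _).ne', sum_categoryProb]

lemma lintegral_likelihoodRatio_swap_le (hβ : ∀ l, BoundedMeasurable (β l))
    (hγ : ∀ l, BoundedMeasurable (γ l)) {δ : ℝ} (hδ0 : 0 ≤ δ) (hδ : δ ≤ 1 / 2)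
    (h : ∀ᵐ x ∂G, ∀ l, |linearPredictor (β l) x - linearPredictor (γ l) x| ≤ δ) :
    ∫⁻ z, ofReal (likelihoodRatio γ β z) ∂(observationLaw G γ) ≤ ofReal (exp (16 * δ ^ 2)) := by
  rw [lintegral_ofReal_observationLaw hγ (measurable_likelihoodRatio hγ hβ)
    fun z => (likelihoodRatio_pos z).le]
  calc ∫⁻ x, ofReal (∑ k, categoryProb γ x k * likelihoodRatio γ β (x, k)) ∂G
      ≤ ∫⁻ _, ofReal (exp (16 * δ ^ 2)) ∂G := by
        refine lintegral_mono_ae ?_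
        filter_upwards [h] with x hx
        have hx' := fun l => abs_sub_comm (linearPredictor (β l) x) _ ▸ hx l
        have hsum := sum_mul_div_le_exp (categoryProb_pos β x) (sum_categoryProb β x)
          (sum_categoryProb γ x) (t := 2 * δ) (by linarith) (categoryProb_le_exp_mul hδ0 hx)
          (categoryProb_le_exp_mul hδ0 hx')
        rw [show 4 * (2 * δ) ^ 2 = 16 * δ ^ 2 by ring] at hsum
        exact ENNReal.ofReal_le_ofReal hsum
    _ = ofReal (exp (16 * δ ^ 2)) := by simp

lemma lintegral_sqrt_likelihoodRatio_le (hβ : ∀ l, BoundedMeasurable (β l))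
    (hγ : ∀ l, BoundedMeasurable (γ l)) :
    ∫⁻ z, ofReal √(likelihoodRatio β γ z) ∂(observationLaw G γ) ≤
      ofReal (exp (-(probDist G β γ ^ 2 / 8))) := by
  set D : Covariate → ℝ := fun x => ∑ k, |categoryProb β x k - categoryProb γ x k| ^ 2
  have hint := integrable_abs_categoryProb_sub_sq (G := G) hβ hγ
  have hD : Integrable D G := integrable_finsetSum _ fun k _ => hint k
  have affinity_le (x : Covariate) :
      ∑ k, categoryProb γ x k * √(likelihoodRatio β γ (x, k)) ≤ 1 - D x / 8 :=
    sum_mul_sqrt_div_le (categoryProb_pos β x) (categoryProb_pos γ x) (sum_categoryProb β x)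
      (sum_categoryProb γ x)
  have hnonneg (x : Covariate) : 0 ≤ 1 - D x / 8 :=
    (Finset.sum_nonneg fun k _ =>
      mul_nonneg (categoryProb_pos γ x k).le (Real.sqrt_nonneg _)).trans (affinity_le x)
  calc ∫⁻ z, ofReal √(likelihoodRatio β γ z) ∂(observationLaw G γ)
      = ∫⁻ x, ofReal (∑ k, categoryProb γ x k * √(likelihoodRatio β γ (x, k))) ∂G :=
        lintegral_ofReal_observationLaw hγ (measurable_likelihoodRatio hβ hγ).sqrt
          fun z => Real.sqrt_nonneg _
    _ ≤ ∫⁻ x, ofReal (1 - D x / 8) ∂G :=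
        lintegral_mono fun x => ENNReal.ofReal_le_ofReal (affinity_le x)
    _ = ofReal (∫ x, (1 - D x / 8) ∂G) :=
        (ofReal_integral_eq_lintegral_ofReal ((integrable_const _).sub (hD.div_const 8))
          (Eventually.of_forall hnonneg)).symm
    _ = ofReal (1 - probDist G β γ ^ 2 / 8) := by
        rw [integral_sub (integrable_const _) (hD.div_const 8), integral_div,
          integral_finsetSum _ fun k _ => hint k, ← probDist_sq]
        simp
    _ ≤ ofReal (exp (-(probDist G β γ ^ 2 / 8))) :=
        ENNReal.ofReal_le_ofReal (Real.one_sub_le_exp_neg _)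

end ObservationLaw

section ExpENNReal

variable {Ω : Type*} [MeasurableSpace Ω]

lemma ofReal_exp_pos (a : ℝ) : 0 < ofReal (exp a) :=
  ENNReal.ofReal_pos.2 (Real.exp_pos a)

lemma ofReal_exp_add (a b : ℝ) : ofReal (exp (a + b)) = ofReal (exp a) * ofReal (exp b) := by
  rw [Real.exp_add, ENNReal.ofReal_mul (Real.exp_pos _).le]

lemma natCast_mul_ofReal_exp_le {N : ℕ} {b : ℝ} (h : N ≤ exp b) (a : ℝ) :
    N * ofReal (exp a) ≤ ofReal (exp (b + a)) := by
  rw [ofReal_exp_add, ← ENNReal.ofReal_natCast]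
  gcongr

lemma ofReal_exp_pow (a : ℝ) (n : ℕ) : ofReal (exp a) ^ n = ofReal (exp (n * a)) := by
  rw [← ENNReal.ofReal_pow (Real.exp_pos _).le, ← Real.exp_nat_mul]

lemma ofReal_exp_rpow (a r : ℝ) : ofReal (exp a) ^ r = ofReal (exp (a * r)) := by
  rw [ENNReal.ofReal_rpow_of_pos (Real.exp_pos _), Real.exp_mul]

lemma ofReal_exp_neg (a : ℝ) : ofReal (exp (-a)) = (ofReal (exp a))⁻¹ := by
  rw [← ENNReal.ofReal_inv_of_pos (Real.exp_pos _), Real.exp_neg]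

lemma measure_exp_neg_le_le (μ : Measure Ω) {f : Ω → ℝ≥0∞} (hf : AEMeasurable f μ) (v : ℝ) :
    μ {ω | ofReal (exp (-v)) ≤ f ω} ≤ ofReal (exp v) * ∫⁻ ω, f ω ∂μ := by
  refine (meas_ge_le_lintegral_div hf (ofReal_exp_pos _).ne' ENNReal.ofReal_ne_top).trans_eq ?_
  rw [div_eq_mul_inv, ← ofReal_exp_neg, neg_neg, mul_comm]

end ExpENNReal

section BayesFormula

variable {Ω S : Type*} [MeasurableSpace Ω] {P : Measure Ω} {L : S → Ω → ℝ≥0∞}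

lemma measure_exists_exp_neg_le_le (hL : ∀ s, Measurable (L s)) {T : Set S}
    (hT : ∀ᵐ ω ∂P, ∀ s ∈ T, ∀ s' ∈ T, L s ω ≤ ofReal (exp 1) * L s' ω) {h : ℝ}
    (hsqrt : ∀ s ∈ T, ∫⁻ ω, L s ω ^ (2⁻¹ : ℝ) ∂P ≤ ofReal (exp (-h))) (v : ℝ) :
    P {ω | ∃ s ∈ T, ofReal (exp (-v)) ≤ L s ω} ≤ ofReal (exp ((v + 1) / 2 - h)) := by
  rcases T.eq_empty_or_nonempty with rfl | ⟨s₀, hs₀⟩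
  · simp
  have hsub : {ω | ∃ s ∈ T, ofReal (exp (-v)) ≤ L s ω} ≤ᵐ[P]
      {ω | ofReal (exp (-((v + 1) / 2))) ≤ L s₀ ω ^ (2⁻¹ : ℝ)} := by
    filter_upwards [hT] with ω hω ⟨s, hs, hle⟩
    have hs₀_le : ofReal (exp (-(v + 1))) ≤ L s₀ ω := by
      rw [neg_add, ofReal_exp_add, ofReal_exp_neg 1, ← div_eq_mul_inv]
      exact ENNReal.div_le_of_le_mul' (hle.trans (hω s hs s₀ hs₀))
    calc ofReal (exp (-((v + 1) / 2))) = ofReal (exp (-(v + 1))) ^ (2⁻¹ : ℝ) := by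
          rw [ofReal_exp_rpow, div_eq_mul_inv, neg_mul]
      _ ≤ L s₀ ω ^ (2⁻¹ : ℝ) := by gcongr
  calc P {ω | ∃ s ∈ T, ofReal (exp (-v)) ≤ L s ω}
      ≤ P {ω | ofReal (exp (-((v + 1) / 2))) ≤ L s₀ ω ^ (2⁻¹ : ℝ)} := measure_mono_ae hsub
    _ ≤ ofReal (exp ((v + 1) / 2)) * ∫⁻ ω, L s₀ ω ^ (2⁻¹ : ℝ) ∂P :=
        measure_exp_neg_le_le P ((hL s₀).pow_const _).aemeasurable _
    _ ≤ ofReal (exp ((v + 1) / 2)) * ofReal (exp (-h)) := by gcongr; exact hsqrt s₀ hs₀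
    _ = ofReal (exp ((v + 1) / 2 - h)) := by rw [← ofReal_exp_add, sub_eq_add_neg]

variable [MeasurableSpace S] {μ : Measure S}

lemma measure_sq_le_lintegral_mul_lintegral_inv {f : S → ℝ≥0∞} (hf : Measurable f)
    (hf0 : ∀ s, f s ≠ 0) (hftop : ∀ s, f s ≠ ∞) (A : Set S) :
    μ A ^ 2 ≤ (∫⁻ s, f s ∂μ) * ∫⁻ s in A, (f s)⁻¹ ∂μ := by
  have holder := ENNReal.lintegral_mul_le_Lp_mul_Lq (μ.restrict A) Real.HolderConjugate.two_two
    (f := fun s => f s ^ (2⁻¹ : ℝ)) (g := fun s => (f s)⁻¹ ^ (2⁻¹ : ℝ))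
    (hf.pow_const _).aemeasurable (hf.inv.pow_const _).aemeasurable
  have sqrt_sq (a : ℝ≥0∞) : (a ^ (2⁻¹ : ℝ)) ^ (2 : ℝ) = a := by
    rw [← ENNReal.rpow_mul, inv_mul_cancel₀ two_ne_zero, ENNReal.rpow_one]
  have sqrt_mul_sqrt_inv (s : S) :
      ((fun s => f s ^ (2⁻¹ : ℝ)) * fun s => (f s)⁻¹ ^ (2⁻¹ : ℝ)) s = 1 := by
    rw [Pi.mul_apply, ← ENNReal.mul_rpow_of_nonneg _ _ (by norm_num),
      ENNReal.mul_inv_cancel (hf0 s) (hftop s), ENNReal.one_rpow]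
  simp only [sqrt_sq, sqrt_mul_sqrt_inv, lintegral_const, one_mul, Measure.restrict_apply_univ,
    one_div, ← ENNReal.mul_rpow_of_nonneg _ _ (by norm_num : (0 : ℝ) ≤ 2⁻¹)] at holder
  calc μ A ^ 2 ≤ (((∫⁻ s in A, f s ∂μ) * ∫⁻ s in A, (f s)⁻¹ ∂μ) ^ (2⁻¹ : ℝ)) ^ 2 := by gcongr
    _ = (∫⁻ s in A, f s ∂μ) * ∫⁻ s in A, (f s)⁻¹ ∂μ := by
        rw [← ENNReal.rpow_two, sqrt_sq]
    _ ≤ (∫⁻ s, f s ∂μ) * ∫⁻ s in A, (f s)⁻¹ ∂μ := by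
        gcongr
        exact Measure.restrict_le_self

lemma exists_lt_of_lt_setLIntegral [IsProbabilityMeasure μ] {f : S → ℝ≥0∞} {T : Set S} {c : ℝ≥0∞}
    (h : c < ∫⁻ s in T, f s ∂μ) : ∃ s ∈ T, c < f s := by
  by_contra! hle
  refine h.not_ge ?_
  calc ∫⁻ s in T, f s ∂μ ≤ ∫⁻ _ in T, c ∂μ := setLIntegral_mono measurable_const hle
    _ = c * μ T := setLIntegral_const T c
    _ ≤ c := mul_le_of_le_one_right' prob_le_one

-- Cauchy–Schwarz turns a small evidence into a large average over `A` of the inverse likelihood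
-- ratios, which Markov's inequality excludes.
lemma measure_evidence_lt_le [SFinite P] [IsFiniteMeasure μ] (hL : Measurable (Function.uncurry L))
    (hL0 : ∀ s ω, L s ω ≠ 0) (hLtop : ∀ s ω, L s ω ≠ ∞) {A : Set S} {a b : ℝ}
    (hA : ∀ s ∈ A, ∫⁻ ω, (L s ω)⁻¹ ∂P ≤ ofReal (exp b)) (ha : ofReal (exp (-a)) ≤ μ A) (c : ℝ) :
    P {ω | ∫⁻ s, L s ω ∂μ < ofReal (exp (-(a + c)))} ≤ ofReal (exp (b - c)) := by
  have hA0 : μ A ≠ 0 := ((ofReal_exp_pos _).trans_le ha).ne'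
  have hswap : Measurable fun q : Ω × S => (L q.2 q.1)⁻¹ := (hL.comp measurable_swap).inv
  have hmeas : Measurable fun ω => ∫⁻ s in A, (L s ω)⁻¹ ∂μ := hswap.lintegral_prod_right'
  have le_inverse_average {ω : Ω} (hω : ∫⁻ s, L s ω ∂μ < ofReal (exp (-(a + c)))) :
      ofReal (exp c) * μ A ≤ ∫⁻ s in A, (L s ω)⁻¹ ∂μ := by
    have hLω : Measurable fun s => L s ω := hL.comp measurable_prodMk_right
    have h : ofReal (exp (-a)) * μ A ≤
        ofReal (exp (-a)) * (ofReal (exp (-c)) * ∫⁻ s in A, (L s ω)⁻¹ ∂μ) := by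
      rw [← mul_assoc, ← ofReal_exp_add, ← neg_add]
      calc ofReal (exp (-a)) * μ A ≤ μ A ^ 2 := by rw [sq]; gcongr
        _ ≤ _ := measure_sq_le_lintegral_mul_lintegral_inv hLω (hL0 · ω) (hLtop · ω) A
        _ ≤ _ := by gcongr
    have h' := (ENNReal.mul_le_mul_iff_right (ofReal_exp_pos _).ne' ENNReal.ofReal_ne_top).1 h
    calc ofReal (exp c) * μ A
        ≤ ofReal (exp c) * (ofReal (exp (-c)) * ∫⁻ s in A, (L s ω)⁻¹ ∂μ) := by gcongr
      _ = ∫⁻ s in A, (L s ω)⁻¹ ∂μ := by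
          rw [← mul_assoc, ← ofReal_exp_add, add_neg_cancel, Real.exp_zero, ENNReal.ofReal_one,
            one_mul]
  calc P {ω | ∫⁻ s, L s ω ∂μ < ofReal (exp (-(a + c)))}
      ≤ P {ω | ofReal (exp c) * μ A ≤ ∫⁻ s in A, (L s ω)⁻¹ ∂μ} :=
        measure_mono fun ω hω => le_inverse_average hω
    _ ≤ (∫⁻ ω, ∫⁻ s in A, (L s ω)⁻¹ ∂μ ∂P) / (ofReal (exp c) * μ A) :=
        meas_ge_le_lintegral_div hmeas.aemeasurable (mul_ne_zero (ofReal_exp_pos _).ne' hA0)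
          (ENNReal.mul_ne_top ENNReal.ofReal_ne_top (measure_ne_top μ A))
    _ = (∫⁻ s in A, ∫⁻ ω, (L s ω)⁻¹ ∂P ∂μ) / (ofReal (exp c) * μ A) := by
        rw [lintegral_lintegral_swap hswap.aemeasurable]
    _ ≤ (ofReal (exp b) * μ A) / (ofReal (exp c) * μ A) := by
        gcongr
        exact (setLIntegral_mono measurable_const hA).trans_eq (setLIntegral_const _ _)
    _ = ofReal (exp (b - c)) := by
        rw [ENNReal.mul_div_mul_right _ _ hA0 (measure_ne_top μ A), sub_eq_add_neg, ofReal_exp_add,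
          ofReal_exp_neg, div_eq_mul_inv]

lemma measure_exp_neg_le_setLIntegral_le [SFinite P] [SFinite μ]
    (hL : Measurable (Function.uncurry L)) (hL1 : ∀ s, ∫⁻ ω, L s ω ∂P ≤ 1) (U : Set S) (v : ℝ) :
    P {ω | ofReal (exp (-v)) ≤ ∫⁻ s in U, L s ω ∂μ} ≤ ofReal (exp v) * μ U := by
  have hswap : Measurable fun q : Ω × S => L q.2 q.1 := hL.comp measurable_swap
  have hmeas : Measurable fun ω => ∫⁻ s in U, L s ω ∂μ := hswap.lintegral_prod_right'
  refine (measure_exp_neg_le_le P hmeas.aemeasurable v).trans ?_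
  rw [lintegral_lintegral_swap hswap.aemeasurable]
  gcongr
  exact (lintegral_mono hL1).trans_eq (by simp)

-- A likelihood that is constant up to the factor `e` on each cell of a cover is controlled
-- uniformly by one point of each cell, so that no separate test functions are needed.
lemma measure_exp_neg_le_setLIntegral_le_card [IsProbabilityMeasure μ] (hL : ∀ s, Measurable (L s))
    {T : Set S} {F : Finset (Set S)} (hTF : ∀ s ∈ T, ∃ U ∈ F, s ∈ U)
    (hF : ∀ᵐ ω ∂P, ∀ U ∈ F, ∀ s ∈ U, ∀ s' ∈ U, L s ω ≤ ofReal (exp 1) * L s' ω) {h : ℝ}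
    (hsqrt : ∀ s ∈ T, ∫⁻ ω, L s ω ^ (2⁻¹ : ℝ) ∂P ≤ ofReal (exp (-h))) (v : ℝ) :
    P {ω | ofReal (exp (-v)) ≤ ∫⁻ s in T, L s ω ∂μ} ≤
      F.card * ofReal (exp ((v + 2) / 2 - h)) := by
  have hsub : {ω | ofReal (exp (-v)) ≤ ∫⁻ s in T, L s ω ∂μ} ⊆
      ⋃ U ∈ F, {ω | ∃ s ∈ U ∩ T, ofReal (exp (-(v + 1))) ≤ L s ω} := fun ω hω => by
    have hlt : ofReal (exp (-(v + 1))) < ∫⁻ s in T, L s ω ∂μ := by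
      refine lt_of_lt_of_le ?_ hω
      exact (ENNReal.ofReal_lt_ofReal_iff (Real.exp_pos _)).2 (Real.exp_lt_exp.2 (by linarith))
    obtain ⟨s, hs, hle⟩ := exists_lt_of_lt_setLIntegral hlt
    obtain ⟨U, hU, hsU⟩ := hTF s hs
    exact Set.mem_biUnion hU ⟨s, ⟨hsU, hs⟩, hle.le⟩
  have hcell (U : Set S) (hU : U ∈ F) :
      P {ω | ∃ s ∈ U ∩ T, ofReal (exp (-(v + 1))) ≤ L s ω} ≤ ofReal (exp ((v + 2) / 2 - h)) := by
    rw [show v + 2 = v + 1 + 1 by ring]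
    refine measure_exists_exp_neg_le_le hL ?_ (fun s hs => hsqrt s hs.2) (v + 1)
    filter_upwards [hF] with ω hω s hs s' hs' using hω U hU s hs.1 s' hs'.1
  calc P {ω | ofReal (exp (-v)) ≤ ∫⁻ s in T, L s ω ∂μ}
      ≤ ∑ U ∈ F, P {ω | ∃ s ∈ U ∩ T, ofReal (exp (-(v + 1))) ≤ L s ω} :=
        (measure_mono hsub).trans (measure_biUnion_finset_le F _)
    _ ≤ F.card • ofReal (exp ((v + 2) / 2 - h)) := Finset.sum_le_card_nsmul F _ _ hcell
    _ = F.card * ofReal (exp ((v + 2) / 2 - h)) := nsmul_eq_mul _ _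

theorem measure_exp_neg_le_bayes_le [SFinite P] [IsProbabilityMeasure μ]
    (hL : Measurable (Function.uncurry L)) (hL0 : ∀ s ω, L s ω ≠ 0) (hLtop : ∀ s ω, L s ω ≠ ∞)
    (hL1 : ∀ s, ∫⁻ ω, L s ω ∂P ≤ 1) {A B V : Set S} {a b : ℝ}
    (hA : ∀ s ∈ A, ∫⁻ ω, (L s ω)⁻¹ ∂P ≤ ofReal (exp b)) (ha : ofReal (exp (-a)) ≤ μ A)
    {F : Finset (Set S)} (hVF : ∀ s ∈ V, ∃ U ∈ F, s ∈ U)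
    (hF : ∀ᵐ ω ∂P, ∀ U ∈ F, ∀ s ∈ U, ∀ s' ∈ U, L s ω ≤ ofReal (exp 1) * L s' ω) {h : ℝ}
    (hB : ∀ s ∈ B, ∫⁻ ω, L s ω ^ (2⁻¹ : ℝ) ∂P ≤ ofReal (exp (-h))) {c τ v : ℝ}
    (hv : v = a + c + τ + 1) :
    P {ω | ofReal (exp (-τ)) ≤ (∫⁻ s in B, L s ω ∂μ) / ∫⁻ s, L s ω ∂μ} ≤
      ofReal (exp (b - c)) +
        (ofReal (exp v) * μ Vᶜ + F.card * ofReal (exp ((v + 2) / 2 - h))) := by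
  have hsub : {ω | ofReal (exp (-τ)) ≤ (∫⁻ s in B, L s ω ∂μ) / ∫⁻ s, L s ω ∂μ} ⊆
      {ω | ∫⁻ s, L s ω ∂μ < ofReal (exp (-(a + c)))} ∪
        ({ω | ofReal (exp (-v)) ≤ ∫⁻ s in Vᶜ, L s ω ∂μ} ∪
          {ω | ofReal (exp (-v)) ≤ ∫⁻ s in B ∩ V, L s ω ∂μ}) := fun ω hω => by
    by_contra! hnot
    simp only [Set.mem_union, Set.mem_ofPred_eq, not_or, not_lt, not_le] at hω hnot
    obtain ⟨hevidence, hVc, hBV⟩ := hnot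
    have two_le_exp : (2 : ℝ≥0∞) ≤ ofReal (exp 1) := by
      rw [show (2 : ℝ≥0∞) = ofReal 2 by simp]
      exact ENNReal.ofReal_le_ofReal (by linarith [Real.add_one_le_exp 1])
    refine lt_irrefl (ofReal (exp 1) * ofReal (exp (-v))) ?_
    calc ofReal (exp 1) * ofReal (exp (-v))
        = ofReal (exp (-τ)) * ofReal (exp (-(a + c))) := by
          rw [← ofReal_exp_add, ← ofReal_exp_add, hv]
          ring_nf
      _ ≤ ∫⁻ s in B, L s ω ∂μ := (mul_le_mul_right hevidence _).trans (ENNReal.mul_le_of_le_div hω)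
      _ ≤ ∫⁻ s in Vᶜ ∪ B ∩ V, L s ω ∂μ := lintegral_mono_set fun s hs => by
          by_cases hsV : s ∈ V
          · exact Or.inr ⟨hs, hsV⟩
          · exact Or.inl hsV
      _ ≤ ∫⁻ s in Vᶜ, L s ω ∂μ + ∫⁻ s in B ∩ V, L s ω ∂μ := lintegral_union_le _ _ _
      _ < ofReal (exp (-v)) + ofReal (exp (-v)) := ENNReal.add_lt_add hVc hBV
      _ ≤ ofReal (exp 1) * ofReal (exp (-v)) := by
          rw [← two_mul]
          gcongr
  refine (measure_mono hsub).trans ((measure_union_le _ _).trans (add_le_add ?_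
    ((measure_union_le _ _).trans (add_le_add ?_ ?_))))
  · exact measure_evidence_lt_le hL hL0 hLtop hA ha c
  · exact measure_exp_neg_le_setLIntegral_le hL hL1 Vᶜ v
  · exact measure_exp_neg_le_setLIntegral_le_card (fun s => hL.comp measurable_prodMk_left)
      (fun s hs => hVF s hs.2) hF (fun s hs => hB s hs.1) v

end BayesFormula

/-- The likelihood ratio of two vectors of coefficient functions for a sample. -/
noncomputable def sampleRatio {m n : ℕ} (β γ : Fin m → unitInterval → ℝ)
    (z : Fin n → Covariate × Fin (m + 1)) : ℝ≥0∞ :=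
  ∏ i, ofReal (likelihoodRatio β γ (z i))

section SampleRatio

variable {m n : ℕ} {β β' γ : Fin m → unitInterval → ℝ} {z : Fin n → Covariate × Fin (m + 1)}

lemma sampleRatio_ne_zero : sampleRatio β γ z ≠ 0 :=
  Finset.prod_ne_zero_iff.2 fun _ _ => (ENNReal.ofReal_pos.2 (likelihoodRatio_pos _)).ne'

lemma sampleRatio_ne_top : sampleRatio β γ z ≠ ∞ :=
  ENNReal.prod_ne_top fun _ _ => ENNReal.ofReal_ne_top

lemma inv_sampleRatio : (sampleRatio β γ z)⁻¹ = sampleRatio γ β z := by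
  refine (ENNReal.eq_inv_of_mul_eq_one_left ?_).symm
  rw [sampleRatio, sampleRatio, ← Finset.prod_mul_distrib]
  refine Finset.prod_eq_one fun i _ => ?_
  rw [← ENNReal.ofReal_mul (likelihoodRatio_pos _).le, likelihoodRatio, likelihoodRatio,
    div_mul_div_cancel₀ (categoryProb_pos _ _ _).ne', div_self (categoryProb_pos _ _ _).ne',
    ENNReal.ofReal_one]

lemma likelihood_ne_zero : likelihood γ z ≠ 0 :=
  Finset.prod_ne_zero_iff.2 fun _ _ => (ENNReal.ofReal_pos.2 (categoryProb_pos _ _ _)).ne'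

lemma likelihood_ne_top : likelihood γ z ≠ ∞ :=
  ENNReal.prod_ne_top fun _ _ => ENNReal.ofReal_ne_top

lemma likelihood_eq_mul_sampleRatio : likelihood β z = likelihood γ z * sampleRatio β γ z := by
  rw [likelihood, likelihood, sampleRatio, ← Finset.prod_mul_distrib]
  refine Finset.prod_congr rfl fun i _ => ?_
  rw [← ENNReal.ofReal_mul (categoryProb_pos _ _ _).le, likelihoodRatio,
    mul_div_cancel₀ _ (categoryProb_pos _ _ _).ne']

lemma posterior_eq_lintegral_sampleRatio_div {ψ : (J : ℕ) → Fin J → unitInterval → ℝ}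
    (prior : Measure (SeriesParam m)) (B : Set (SeriesParam m)) :
    posterior ψ prior z B = (∫⁻ s in B, sampleRatio (s.coeff ψ) γ z ∂prior) /
      ∫⁻ s, sampleRatio (s.coeff ψ) γ z ∂prior := by
  have factor (s : SeriesParam m) :
      likelihood (s.coeff ψ) z = likelihood γ z * sampleRatio (s.coeff ψ) γ z :=
    likelihood_eq_mul_sampleRatio
  simp_rw [posterior, factor]
  rw [lintegral_const_mul' _ _ likelihood_ne_top, lintegral_const_mul' _ _ likelihood_ne_top,
    ENNReal.mul_div_mul_left _ _ likelihood_ne_zero likelihood_ne_top]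

lemma sampleRatio_le_exp_mul {η : ℝ} (hη : 0 ≤ η)
    (h : ∀ i l, |linearPredictor (β l) (z i).1 - linearPredictor (β' l) (z i).1| ≤ η) :
    sampleRatio β γ z ≤ ofReal (exp (n * (2 * η))) * sampleRatio β' γ z := by
  calc sampleRatio β γ z
      ≤ ∏ i, ofReal (exp (2 * η)) * ofReal (likelihoodRatio β' γ (z i)) := by
        refine Finset.prod_le_prod' fun i _ => ?_
        rw [← ENNReal.ofReal_mul (Real.exp_pos _).le, likelihoodRatio, likelihoodRatio,
          ← mul_div_assoc]
        exact ENNReal.ofReal_le_ofReal (div_le_div_of_nonneg_right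
          (categoryProb_le_exp_mul hη (h i) _) (categoryProb_pos _ _ _).le)
    _ = ofReal (exp (n * (2 * η))) * sampleRatio β' γ z := by
        rw [Finset.prod_mul_distrib, Finset.prod_const, Finset.card_univ, Fintype.card_fin,
          ofReal_exp_pow, sampleRatio]

variable {G : Measure Covariate} [IsProbabilityMeasure G]

lemma isProbabilityMeasure_sampleLaw (hγ : ∀ l, BoundedMeasurable (γ l)) (n : ℕ) :
    IsProbabilityMeasure (sampleLaw G γ n) := by
  have := isProbabilityMeasure_observationLaw (G := G) hγ
  unfold sampleLaw
  infer_instance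

lemma lintegral_prod_sampleLaw (hγ : ∀ l, BoundedMeasurable (γ l))
    {f : Covariate × Fin (m + 1) → ℝ≥0∞} (hf : Measurable f) :
    ∫⁻ z, ∏ i, f (z i) ∂(sampleLaw G γ n) = (∫⁻ z, f z ∂(observationLaw G γ)) ^ n := by
  have := isProbabilityMeasure_observationLaw (G := G) hγ
  have hindep := ProbabilityTheory.iIndepFun_pi (X := fun _ : Fin n => f)
    (μ := fun _ => observationLaw G γ) fun _ => hf.aemeasurable
  calc ∫⁻ z, ∏ i, f (z i) ∂(sampleLaw G γ n)
      = ∏ i, ∫⁻ z, f (z i) ∂(sampleLaw G γ n) :=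
        ProbabilityTheory.lintegral_prod_eq_prod_lintegral_of_indepFun Finset.univ
          (fun i (z : Fin n → Covariate × Fin (m + 1)) => f (z i)) hindep
          fun i => hf.comp (measurable_pi_apply i)
    _ = ∏ _i : Fin n, ∫⁻ w, f w ∂(observationLaw G γ) := Finset.prod_congr rfl fun i _ =>
        (measurePreserving_eval (fun _ => observationLaw G γ) i).lintegral_comp hf
    _ = (∫⁻ z, f z ∂(observationLaw G γ)) ^ n := by
        rw [Finset.prod_const, Finset.card_univ, Fintype.card_fin]

lemma ae_sampleLaw_norm_le (hγ : ∀ l, BoundedMeasurable (γ l)) {R : ℝ} (hG : ∀ᵐ x ∂G, ‖x‖ ≤ R) :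
    ∀ᵐ z ∂(sampleLaw G γ n), ∀ i, ‖(z i).1‖ ≤ R := by
  have := isProbabilityMeasure_observationLaw (G := G) hγ
  have hobs : ∀ᵐ w ∂(observationLaw G γ), ‖w.1‖ ≤ R :=
    (withDensity_absolutelyContinuous _ _).ae_le (Measure.quasiMeasurePreserving_fst.ae hG)
  exact ae_all_iff.2 fun i =>
    (Measure.quasiMeasurePreserving_eval (fun _ : Fin n => observationLaw G γ) i).ae hobs

lemma lintegral_sampleRatio (hβ : ∀ l, BoundedMeasurable (β l))
    (hγ : ∀ l, BoundedMeasurable (γ l)) :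
    ∫⁻ z, sampleRatio β γ z ∂(sampleLaw G γ n) = 1 := by
  simp only [sampleRatio]
  rw [lintegral_prod_sampleLaw hγ (measurable_likelihoodRatio hβ hγ).ennreal_ofReal,
    lintegral_likelihoodRatio hβ hγ, one_pow]

lemma lintegral_inv_sampleRatio_le (hβ : ∀ l, BoundedMeasurable (β l))
    (hγ : ∀ l, BoundedMeasurable (γ l)) {δ : ℝ} (hδ0 : 0 ≤ δ) (hδ : δ ≤ 1 / 2)
    (h : ∀ᵐ x ∂G, ∀ l, |linearPredictor (β l) x - linearPredictor (γ l) x| ≤ δ) :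
    ∫⁻ z, (sampleRatio β γ z)⁻¹ ∂(sampleLaw G γ n) ≤ ofReal (exp (n * (16 * δ ^ 2))) := by
  simp only [inv_sampleRatio]
  simp only [sampleRatio]
  rw [lintegral_prod_sampleLaw hγ (measurable_likelihoodRatio hγ hβ).ennreal_ofReal,
    ← ofReal_exp_pow]
  gcongr
  exact lintegral_likelihoodRatio_swap_le hβ hγ hδ0 hδ h

lemma lintegral_sqrt_sampleRatio_le (hβ : ∀ l, BoundedMeasurable (β l))
    (hγ : ∀ l, BoundedMeasurable (γ l)) :
    ∫⁻ z, sampleRatio β γ z ^ (2⁻¹ : ℝ) ∂(sampleLaw G γ n) ≤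
      ofReal (exp (-(n * (probDist G β γ ^ 2 / 8)))) := by
  have sqrt_ratio (z : Fin n → Covariate × Fin (m + 1)) :
      sampleRatio β γ z ^ (2⁻¹ : ℝ) = ∏ i, ofReal √(likelihoodRatio β γ (z i)) := by
    rw [sampleRatio, ← ENNReal.prod_rpow_of_nonneg (by norm_num)]
    refine Finset.prod_congr rfl fun i _ => ?_
    rw [ENNReal.ofReal_rpow_of_pos (likelihoodRatio_pos _), Real.sqrt_eq_rpow, one_div]
  simp only [sqrt_ratio]
  rw [lintegral_prod_sampleLaw hγ (measurable_likelihoodRatio hβ hγ).sqrt.ennreal_ofReal,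
    ← mul_neg, ← ofReal_exp_pow]
  gcongr
  exact lintegral_sqrt_likelihoodRatio_le hβ hγ

end SampleRatio

lemma measurableEmbedding_sigmaMk {ι : Type*} {E : ι → Type*} [∀ i, MeasurableSpace (E i)]
    (i : ι) : MeasurableEmbedding (Sigma.mk i : E i → Σ i, E i) where
  injective := sigma_mk_injective
  measurable := measurable_iff_le_map.2 (iInf_le _ i)
  measurableSet_image' := fun {s} hs => by
    refine MeasurableSpace.measurableSet_iInf.2 fun j => ?_
    change MeasurableSet (Sigma.mk j ⁻¹' (Sigma.mk i '' s))
    by_cases h : i = j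
    · subst h
      rwa [sigma_mk_preimage_image_eq_self]
    · rw [sigma_mk_preimage_image' h]
      exact MeasurableSet.empty

lemma measurable_sigma_prod {ι : Type*} [Countable ι] {E : ι → Type*}
    [∀ i, MeasurableSpace (E i)] {Z Y : Type*} [MeasurableSpace Z] [MeasurableSpace Y]
    {f : (Σ i, E i) × Z → Y} (h : ∀ i, Measurable fun q : E i × Z => f (⟨i, q.1⟩, q.2)) :
    Measurable f := fun s hs => by
  have hpreimage : f ⁻¹' s = ⋃ i, Prod.map (Sigma.mk i) id ''
      ((fun q : E i × Z => f (⟨i, q.1⟩, q.2)) ⁻¹' s) := by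
    ext ⟨⟨i, e⟩, z⟩
    simp only [Set.mem_preimage, Set.mem_iUnion, Set.mem_image, Prod.exists]
    constructor
    · exact fun h => ⟨i, e, z, h, rfl⟩
    · rintro ⟨j, a, w, hw, heq⟩
      simp only [Prod.map_apply, id_eq] at heq
      rwa [heq] at hw
  rw [hpreimage]
  exact MeasurableSet.iUnion fun i =>
    ((measurableEmbedding_sigmaMk i).prodMap MeasurableEmbedding.id).measurableSet_image.2 (h i hs)

lemma measurable_sampleRatio {m n : ℕ} {Ω : Type*} [MeasurableSpace Ω]
    {b : Ω → Fin m → unitInterval → ℝ} {γ : Fin m → unitInterval → ℝ}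
    (hb : ∀ l, Measurable fun q : Ω × Covariate => linearPredictor (b q.1 l) q.2)
    (hγ : ∀ l, BoundedMeasurable (γ l)) :
    Measurable fun q : Ω × (Fin n → Covariate × Fin (m + 1)) => sampleRatio (b q.1) γ q.2 := by
  have hratio : Measurable fun q : (Ω × Covariate) × Fin (m + 1) =>
      likelihoodRatio (b q.1.1) γ (q.1.2, q.2) :=
    measurable_from_prod_countable_left fun k =>
      (measurable_categoryProb_of_linearPredictor (b := fun q : Ω × Covariate => b q.1)
        (X := Prod.snd) hb k).div ((measurable_categoryProb hγ k).comp measurable_snd)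
  unfold sampleRatio
  refine Finset.measurable_fun_prod _ fun i _ => Measurable.ennreal_ofReal ?_
  have hobs : Measurable fun q : Ω × (Fin n → Covariate × Fin (m + 1)) =>
      ((q.1, (q.2 i).1), (q.2 i).2) := by
    fun_prop
  simpa only [Prod.mk.eta] using hratio.fun_comp hobs

section Series

variable {J : ℕ} {φ : Fin J → unitInterval → ℝ}

lemma BoundedMeasurable.series (hφ : ∀ j, BoundedMeasurable (φ j))
    (θ : EuclideanSpace ℝ (Fin J)) : BoundedMeasurable (series φ θ) := by
  refine ⟨Finset.measurable_fun_sum _ fun j _ => (hφ j).1.const_mul _, ?_⟩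
  choose B hB using fun j => (hφ j).2
  refine ⟨∑ j, |θ j| * B j, fun t => (Finset.abs_sum_le_sum_abs _ _).trans ?_⟩
  refine Finset.sum_le_sum fun j _ => ?_
  rw [abs_mul]
  exact mul_le_mul_of_nonneg_left (hB j t) (abs_nonneg _)

lemma linearPredictor_series (hφ : ∀ j, BoundedMeasurable (φ j))
    (θ : EuclideanSpace ℝ (Fin J)) (x : Covariate) :
    linearPredictor (series φ θ) x = ∑ j, θ j * linearPredictor (φ j) x := by
  simp only [linearPredictor, series, Finset.sum_mul, mul_assoc]
  rw [integral_finsetSum _ fun j _ => ((hφ j).integrable_mul x).const_mul _]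
  simp only [integral_const_mul]

lemma measurable_linearPredictor_series (hφ : ∀ j, BoundedMeasurable (φ j)) :
    Measurable fun q : EuclideanSpace ℝ (Fin J) × Covariate =>
      linearPredictor (series φ q.1) q.2 := by
  simp only [linearPredictor_series hφ]
  refine Finset.measurable_fun_sum _ fun j _ => Measurable.mul (by fun_prop)
    ((continuous_linearPredictor (hφ j)).measurable.comp measurable_snd)

lemma measurable_sampleRatio_coeff {m n : ℕ} {ψ : (J : ℕ) → Fin J → unitInterval → ℝ}
    (hψ : ∀ J j, BoundedMeasurable (ψ J j)) {γ : Fin m → unitInterval → ℝ}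
    (hγ : ∀ l, BoundedMeasurable (γ l)) :
    Measurable fun q : SeriesParam m × (Fin n → Covariate × Fin (m + 1)) =>
      sampleRatio (q.1.coeff ψ) γ q.2 :=
  measurable_sampleRatio (fun l => measurable_sigma_prod fun J => by
    have hcoord : Measurable fun q : (Fin m → EuclideanSpace ℝ (Fin J)) × Covariate =>
        (q.1 l, q.2) := by
      fun_prop
    exact (measurable_linearPredictor_series (hψ J)).fun_comp hcoord) hγ

end Series

/-- The parameters whose coefficient functions are uniformly within `δ` of `β₀`. -/
def supNeighborhood {m : ℕ} (ψ : (J : ℕ) → Fin J → unitInterval → ℝ)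
    (β₀ : Fin m → unitInterval → ℝ) (δ : ℝ) : Set (SeriesParam m) :=
  {s | ∀ l t, |s.coeff ψ l t - β₀ l t| ≤ δ}

lemma supNeighborhood_mono {m : ℕ} {ψ : (J : ℕ) → Fin J → unitInterval → ℝ}
    {β₀ : Fin m → unitInterval → ℝ} {δ δ' : ℝ} (h : δ ≤ δ') :
    supNeighborhood ψ β₀ δ ⊆ supNeighborhood ψ β₀ δ' :=
  fun _ hs l t => (hs l t).trans h

/-- The sets in `F` cover the sieve `V`, and the coefficient functions of two parameters in the same
set of `F` are uniformly within `η` of each other. -/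
def IsSupCover {m : ℕ} (ψ : (J : ℕ) → Fin J → unitInterval → ℝ) (η : ℝ)
    (V : Set (SeriesParam m)) (F : Finset (Set (SeriesParam m))) : Prop :=
  (∀ s ∈ V, ∃ U ∈ F, s ∈ U) ∧
    ∀ U ∈ F, ∀ s ∈ U, ∀ s' ∈ U, ∀ l t, |s.coeff ψ l t - s'.coeff ψ l t| ≤ η

lemma IsSupCover.mono {m : ℕ} {ψ : (J : ℕ) → Fin J → unitInterval → ℝ} {η η' : ℝ}
    {V : Set (SeriesParam m)} {F : Finset (Set (SeriesParam m))} (hF : IsSupCover ψ η V F)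
    (h : η ≤ η') : IsSupCover ψ η' V F :=
  ⟨hF.1, fun U hU s hs s' hs' l t => (hF.2 U hU s hs s' hs' l t).trans h⟩

section PosteriorBound

variable {m n : ℕ} {G : Measure Covariate} [IsProbabilityMeasure G]
  {ψ : (J : ℕ) → Fin J → unitInterval → ℝ} {β₀ : Fin m → unitInterval → ℝ}
  {prior : Measure (SeriesParam m)} [IsProbabilityMeasure prior]

theorem sampleLaw_exp_neg_le_posterior_le (hψ : ∀ J j, BoundedMeasurable (ψ J j))
    (hβ₀ : ∀ l, BoundedMeasurable (β₀ l)) {R : ℝ} (hR : 0 ≤ R) (hG : ∀ᵐ x ∂G, ‖x‖ ≤ R)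
    {a δ : ℝ} (hδ0 : 0 ≤ δ) (hδ : R * δ ≤ 1 / 2)
    (ha : ofReal (exp (-a)) ≤ prior (supNeighborhood ψ β₀ δ)) {η : ℝ} (hη0 : 0 ≤ η)
    (hη : 2 * R * (n * η) ≤ 1) {V : Set (SeriesParam m)} {F : Finset (Set (SeriesParam m))}
    (hF : IsSupCover ψ η V F) {r : ℝ} (hr : 0 ≤ r) {c τ v : ℝ} (hv : v = a + c + τ + 1) :
    sampleLaw G β₀ n {z | ofReal (exp (-τ)) ≤
        posterior ψ prior z {s | r ≤ probDist G (s.coeff ψ) β₀}} ≤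
      ofReal (exp (n * (16 * (R * δ) ^ 2) - c)) +
        (ofReal (exp v) * prior Vᶜ +
          F.card * ofReal (exp ((v + 2) / 2 - n * (r ^ 2 / 8)))) := by
  have := isProbabilityMeasure_sampleLaw (G := G) hβ₀ n
  have hcoeff (s : SeriesParam m) (l : Fin m) : BoundedMeasurable (s.coeff ψ l) :=
    .series (hψ s.1) (s.2 l)
  have predictor_close {s : SeriesParam m} {β : Fin m → unitInterval → ℝ} {ρ : ℝ}
      (hβ : ∀ l, BoundedMeasurable (β l)) (hρ : 0 ≤ ρ)
      (h : ∀ l t, |s.coeff ψ l t - β l t| ≤ ρ) {x : Covariate} (hx : ‖x‖ ≤ R) (l : Fin m) :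
      |linearPredictor (s.coeff ψ l) x - linearPredictor (β l) x| ≤ R * ρ :=
    calc |linearPredictor (s.coeff ψ l) x - linearPredictor (β l) x| ≤ ρ * ‖x‖ :=
          abs_linearPredictor_sub_le (hcoeff s l) (hβ l) (h l) x
      _ ≤ ρ * R := by gcongr
      _ = R * ρ := mul_comm _ _
  simp_rw [posterior_eq_lintegral_sampleRatio_div (γ := β₀)]
  refine measure_exp_neg_le_bayes_le (measurable_sampleRatio_coeff hψ hβ₀)
    (fun _ _ => sampleRatio_ne_zero) (fun _ _ => sampleRatio_ne_top)
    (fun s => (lintegral_sampleRatio (hcoeff s) hβ₀).le) (fun s hs => ?_) ha hF.1 ?_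
    (fun s hs => (lintegral_sqrt_sampleRatio_le (hcoeff s) hβ₀).trans ?_) hv
  · refine lintegral_inv_sampleRatio_le (hcoeff s) hβ₀ (mul_nonneg hR hδ0) hδ ?_
    filter_upwards [hG] with x hx using predictor_close hβ₀ hδ0 hs hx
  · filter_upwards [ae_sampleLaw_norm_le hβ₀ hG] with z hz U hU s hs s' hs'
    refine (sampleRatio_le_exp_mul (mul_nonneg hR hη0) fun i =>
      predictor_close (hcoeff s') hη0 (hF.2 U hU s hs s' hs') (hz i)).trans ?_
    gcongr
    linarith
  · gcongr
    exact hs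

end PosteriorBound

section Contraction

lemma tendsto_ofReal_exp_zero {ι : Type*} {l : Filter ι} {f : ι → ℝ} (h : Tendsto f l atBot) :
    Tendsto (fun i => ofReal (exp (f i))) l (𝓝 0) := by
  rw [← ENNReal.ofReal_zero]
  exact ENNReal.tendsto_ofReal (Real.tendsto_exp_atBot.comp h)

lemma eventually_const_mul_le {ι : Type*} {l : Filter ι} {f : ι → ℝ} (hf : Tendsto f l (𝓝 0))
    (c : ℝ) {b : ℝ} (hb : 0 < b) : ∀ᶠ i in l, c * f i ≤ b := by
  have hcf := hf.const_mul c
  rw [mul_zero] at hcf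
  exact hcf.eventually_le_const hb

lemma tendsto_add_sub_sq_mul_atBot {ι : Type*} {l : Filter ι} {N T M : ι → ℝ}
    (hN : Tendsto N l atTop) (hTN : T =O[l] N) (hM : Tendsto M l atTop) (b c d : ℝ) :
    Tendsto (fun i => b * N i + c * T i + d - N i * (M i ^ 2 / 8)) l atBot := by
  obtain ⟨E, hE⟩ := hTN.bound
  refine tendsto_atBot_mono' l ?_
    (tendsto_atBot_add_const_right l d (tendsto_neg_atTop_atBot.comp hN))
  filter_upwards [hE, hN.eventually_ge_atTop 0, hM.eventually_ge_atTop 1,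
    hM.eventually_ge_atTop (8 * (b + |c| * E + 1))] with i hTi hNi hM1 hMi
  rw [Real.norm_eq_abs, Real.norm_of_nonneg hNi] at hTi
  have hcT : c * T i ≤ |c| * E * N i :=
    calc c * T i ≤ |c * T i| := le_abs_self _
      _ = |c| * |T i| := abs_mul _ _
      _ ≤ |c| * (E * N i) := by gcongr
      _ = |c| * E * N i := by ring
  have hsq : b + |c| * E + 1 ≤ M i ^ 2 / 8 := by nlinarith
  have := mul_le_mul_of_nonneg_left hsq hNi
  simp only [Function.comp_apply]
  linarith

variable {m : ℕ} {G : Measure Covariate} [IsProbabilityMeasure G]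
  {ψ : (J : ℕ) → Fin J → unitInterval → ℝ} {β₀ : Fin m → unitInterval → ℝ}
  {prior : Measure (SeriesParam m)} [IsProbabilityMeasure prior]

theorem posteriorContractsAtRate_of_prior_mass_of_sieve (hG : ∃ R : ℝ, ∀ᵐ x ∂G, ‖x‖ ≤ R)
    (hψ : ∀ J j, BoundedMeasurable (ψ J j)) (hβ₀ : ∀ l, BoundedMeasurable (β₀ l))
    {ε T δ η : ℕ → ℝ} (hε : ∀ n, 0 < ε n) (hT : Tendsto T atTop atTop)
    (hTε : T =O[atTop] fun n : ℕ => n * ε n ^ 2) (hδ0 : ∀ n, 0 ≤ δ n)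
    (hδ : Tendsto δ atTop (𝓝 0)) (hδT : (fun n : ℕ => n * δ n ^ 2) =O[atTop] T)
    (hmass : ∃ a, ∀ᶠ n in atTop, ofReal (exp (-(a * T n))) ≤ prior (supNeighborhood ψ β₀ (δ n)))
    (hη0 : ∀ n, 0 ≤ η n) (hη : Tendsto (fun n : ℕ => n * η n) atTop (𝓝 0))
    (hsieve : ∀ c, ∃ V : ℕ → Set (SeriesParam m),
      Tendsto (fun n => ofReal (exp (c * T n)) * prior (V n)ᶜ) atTop (𝓝 0) ∧
      ∃ b, ∀ᶠ n : ℕ in atTop, ∃ F : Finset (Set (SeriesParam m)),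
        IsSupCover ψ (η n) (V n) F ∧ (F.card : ℝ) ≤ exp (b * (n * ε n ^ 2))) :
    PosteriorContractsAtRate G ψ prior β₀ ε := by
  intro M hM ρ hρ
  obtain ⟨R, hR⟩ := hG
  replace hR : ∀ᵐ x ∂G, ‖x‖ ≤ |R| := hR.mono fun x hx => hx.trans (le_abs_self R)
  obtain ⟨a, ha⟩ := hmass
  obtain ⟨D, hD⟩ := hδT.bound
  -- `κ T` exceeds the divergence `n * 16 (R δ)²` paid on the neighborhood of `β₀` by `T`.
  set κ : ℝ := 16 * |R| ^ 2 * D + 1 with hκ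
  obtain ⟨V, hV, b, hb⟩ := hsieve (a + κ + 1)
  have hN : Tendsto (fun n : ℕ => n * ε n ^ 2) atTop atTop :=
    (hTε.trans_tendsto_norm_atTop (tendsto_norm_atTop_atTop.comp hT)).congr fun n =>
      Real.norm_of_nonneg (by positivity)
  have hevidence := tendsto_ofReal_exp_zero (tendsto_neg_atTop_atBot.comp hT)
  have hoff := ENNReal.Tendsto.const_mul (a := ofReal (exp 1)) hV (.inr ENNReal.ofReal_ne_top)
  have htest := tendsto_ofReal_exp_zero
    (tendsto_add_sub_sq_mul_atBot hN hTε hM b ((a + κ + 1) / 2) (3 / 2))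
  have hsum := hevidence.add (hoff.add htest)
  simp only [mul_zero, add_zero] at hsum
  refine tendsto_of_tendsto_of_tendsto_of_le_of_le' tendsto_const_nhds hsum
    (.of_forall fun _ => zero_le) ?_
  filter_upwards [ha, hb, hD, eventually_const_mul_le hδ |R| one_half_pos,
    eventually_const_mul_le hη (2 * |R|) one_pos, hM.eventually_ge_atTop 0,
    hT.eventually_ge_atTop 0, hevidence.eventually_le_const hρ]
    with n ha ⟨F, hF, hcard⟩ hD hδn hηn hMn hTn hρn
  rw [Real.norm_of_nonneg (by positivity), Real.norm_of_nonneg hTn] at hD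
  refine (measure_mono fun z hz => hρn.trans hz).trans <|
    (sampleLaw_exp_neg_le_posterior_le hψ hβ₀ (abs_nonneg R) hR (hδ0 n) hδn ha (hη0 n) hηn hF
      (mul_nonneg hMn (hε n).le) (c := κ * T n) (v := (a + κ + 1) * T n + 1) (by ring)).trans ?_
  gcongr ofReal (exp ?_) + (?_ + ?_)
  · have := mul_le_mul_of_nonneg_left hD (by positivity : 0 ≤ 16 * |R| ^ 2)
    simp only [Function.comp_apply, hκ]
    linarith
  · rw [add_comm, ofReal_exp_add, mul_assoc]
  · refine (natCast_mul_ofReal_exp_le hcard _).trans_eq ?_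
    ring_nf

end Contraction

/-- The first half of `CoefficientPriorCondition`: small balls around every point of the cube
`[-H, H]^J` have mass at least `exp (-c J log (1/ε))`. -/
def CoefficientMassCondition (Q : (J : ℕ) → Measure (EuclideanSpace ℝ (Fin J))) (H : ℝ) : Prop :=
  ∃ c > (0 : ℝ), ∃ ε₀ > (0 : ℝ), ∃ b ≥ (0 : ℝ), ∀ J : ℕ, 1 ≤ J →
    ∀ θ₀ : EuclideanSpace ℝ (Fin J), (∀ j, |θ₀ j| ≤ H) →
    ∀ ε : ℝ, 0 < ε → ε ≤ ε₀ * (J : ℝ) ^ (-b) →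
      exp (-c * J * log (1 / ε)) ≤ (Q J).real {θ | ‖θ - θ₀‖ ≤ ε}

/-- The second half of `CoefficientPriorCondition`, with an arbitrary positive real exponent: the
exponent `t₃` there elaborates to a natural number. -/
def CoefficientTailCondition (Q : (J : ℕ) → Measure (EuclideanSpace ℝ (Fin J))) : Prop :=
  ∃ C > (0 : ℝ), ∃ t > (0 : ℝ), ∀ᶠ M : ℝ in atTop, ∀ J : ℕ, 1 ≤ J →
    (Q J).real {θ | ¬ ∀ j, θ j ∈ Set.Icc (-M) M} ≤ J * exp (-C * M ^ t)

lemma tendsto_log_natCast : Tendsto (fun n : ℕ => log n) atTop atTop :=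
  Real.tendsto_log_atTop.comp tendsto_natCast_atTop_atTop

section Basis

variable {ψ : (J : ℕ) → Fin J → unitInterval → ℝ} {K₀ : ℝ}

lemma BasisLipschitzCondition.mono {K : ℝ} (h : BasisLipschitzCondition ψ K₀) (hK : K₀ ≤ K) :
    BasisLipschitzCondition ψ K := by
  obtain ⟨C, hC, h⟩ := h
  refine ⟨C, hC, fun J hJ θ₁ θ₂ t => (h J hJ θ₁ θ₂ t).trans ?_⟩
  have : (1 : ℝ) ≤ J := by exact_mod_cast hJ
  gcongr

lemma BasisLipschitzCondition.boundedMeasurable (h : BasisLipschitzCondition ψ K₀)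
    (hψ : ∀ J j, Measurable (ψ J j)) (J : ℕ) (j : Fin J) : BoundedMeasurable (ψ J j) := by
  obtain ⟨C, -, h⟩ := h
  refine ⟨hψ J j, C * (J : ℝ) ^ K₀ * ‖EuclideanSpace.single j (1 : ℝ) - 0‖, fun t => ?_⟩
  simpa [series] using h J (Nat.one_le_of_lt j.2) (EuclideanSpace.single j 1) 0 t

lemma ApproximationCondition.boundedMeasurable {β : unitInterval → ℝ} {H α : ℝ} (hα : 0 < α)
    (hψ : ∀ J j, BoundedMeasurable (ψ J j)) (h : ApproximationCondition ψ β H α) :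
    BoundedMeasurable β := by
  obtain ⟨C, -, h⟩ := h
  choose θ _ hθ using fun n : ℕ => h (n + 1) (Nat.le_add_left 1 n)
  constructor
  · refine measurable_of_tendsto_metrizable (fun n => (BoundedMeasurable.series (hψ _) (θ n)).1)
      (tendsto_pi_nhds.2 fun t => tendsto_iff_dist_tendsto_zero.2 ?_)
    have herror : Tendsto (fun n : ℕ => C * ((n + 1 : ℕ) : ℝ) ^ (-α)) atTop (𝓝 0) := by
      simpa using ((tendsto_rpow_neg_atTop hα).comp
        (tendsto_natCast_atTop_atTop.comp (tendsto_add_atTop_nat 1))).const_mul C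
    refine squeeze_zero (fun _ => dist_nonneg) (fun n => ?_) herror
    rw [dist_comm]
    exact hθ n t
  · obtain ⟨B, hB⟩ := (BoundedMeasurable.series (hψ 1) (θ 0)).2
    refine ⟨C * ((0 + 1 : ℕ) : ℝ) ^ (-α) + B, fun t => ?_⟩
    have := abs_sub_abs_le_abs_sub (β t) (series (ψ 1) (θ 0) t)
    linarith [hθ 0 t, hB t]

end Basis

section CoefficientMass

variable {Q : (J : ℕ) → Measure (EuclideanSpace ℝ (Fin J))} [∀ J, IsFiniteMeasure (Q J)] {H : ℝ}

lemma CoefficientMassCondition.exists_exp_neg_le_rpow_ball (hQ : CoefficientMassCondition Q H)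
    (u : ℝ) : ∃ c, ∀ᶠ j : ℕ in atTop, ∀ θ₀ : EuclideanSpace ℝ (Fin j), (∀ i, |θ₀ i| ≤ H) →
      ofReal (exp (-(c * (j * log j)))) ≤ Q j {θ | ‖θ - θ₀‖ ≤ (j : ℝ) ^ (-u)} := by
  obtain ⟨c, -, ε₀, hε₀, b, -, hQ⟩ := hQ
  set v := max u (b + 1)
  refine ⟨c * v, ?_⟩
  filter_upwards [eventually_ge_atTop 1,
    tendsto_natCast_atTop_atTop.eventually_ge_atTop ε₀⁻¹] with j hj hjε θ₀ hθ₀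
  have hj1 : (1 : ℝ) ≤ j := by exact_mod_cast hj
  have hj0 : (0 : ℝ) < j := by positivity
  have hsmall : (j : ℝ) ^ (-v) ≤ ε₀ * (j : ℝ) ^ (-b) :=
    calc (j : ℝ) ^ (-v) ≤ (j : ℝ) ^ (-b + -1) :=
          Real.rpow_le_rpow_of_exponent_le hj1 (by linarith [le_max_right u (b + 1)])
      _ = (j : ℝ)⁻¹ * (j : ℝ) ^ (-b) := by
          rw [Real.rpow_add hj0, Real.rpow_neg_one, mul_comm]
      _ ≤ ε₀ * (j : ℝ) ^ (-b) := by
          gcongr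
          exact inv_le_of_inv_le₀ hε₀ hjε
  calc ofReal (exp (-(c * v * (j * log j))))
      = ofReal (exp (-c * j * log (1 / (j : ℝ) ^ (-v)))) := by
        rw [one_div, ← Real.rpow_neg hj0.le, neg_neg, Real.log_rpow hj0]
        ring_nf
    _ ≤ Q j {θ | ‖θ - θ₀‖ ≤ (j : ℝ) ^ (-v)} := by
        rw [← ofReal_measureReal]
        exact ENNReal.ofReal_le_ofReal (hQ j hj θ₀ hθ₀ _ (by positivity) hsmall)
    _ ≤ Q j {θ | ‖θ - θ₀‖ ≤ (j : ℝ) ^ (-u)} := by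
        refine measure_mono fun θ (hθ : ‖θ - θ₀‖ ≤ _) => hθ.trans ?_
        gcongr
        exact le_max_left _ _

lemma CoefficientMassCondition.exists_exp_neg_le_series_ball
    {ψ : (J : ℕ) → Fin J → unitInterval → ℝ} {β : unitInterval → ℝ} {α K₀ : ℝ}
    (hQ : CoefficientMassCondition Q H) (happrox : ApproximationCondition ψ β H α)
    (hbasis : BasisLipschitzCondition ψ K₀) :
    ∃ c C, ∀ᶠ j : ℕ in atTop, ofReal (exp (-(c * (j * log j)))) ≤
      Q j {θ | ∀ t, |series (ψ j) θ t - β t| ≤ C * (j : ℝ) ^ (-α)} := by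
  obtain ⟨c, hc⟩ := hQ.exists_exp_neg_le_rpow_ball (K₀ + α)
  obtain ⟨C₁, -, happrox⟩ := happrox
  obtain ⟨C₂, hC₂, hbasis⟩ := hbasis
  refine ⟨c, C₂ + C₁, ?_⟩
  filter_upwards [hc, eventually_ge_atTop 1] with j hj hj1
  obtain ⟨θ₀, hθ₀, hθ₀β⟩ := happrox j hj1
  refine (hj θ₀ hθ₀).trans (measure_mono fun θ (hθ : ‖θ - θ₀‖ ≤ _) t => ?_)
  have hj0 : (0 : ℝ) < j := by exact_mod_cast hj1
  calc |series (ψ j) θ t - β t|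
      ≤ |series (ψ j) θ t - series (ψ j) θ₀ t| + |series (ψ j) θ₀ t - β t| := abs_sub_le _ _ _
    _ ≤ C₂ * (j : ℝ) ^ K₀ * (j : ℝ) ^ (-(K₀ + α)) + C₁ * (j : ℝ) ^ (-α) := by
        gcongr
        · exact (hbasis j hj1 θ θ₀ t).trans (by gcongr)
        · exact abs_sub_comm (β t) _ ▸ hθ₀β t
    _ = (C₂ + C₁) * (j : ℝ) ^ (-α) := by
        rw [mul_assoc, ← Real.rpow_add hj0]
        ring_nf

lemma CoefficientTailCondition.exists_pow_tail_le (hQ : CoefficientTailCondition Q) :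
    ∃ q₀ : ℕ, ∀ q ≥ q₀, ∀ᶠ n : ℕ in atTop, ∀ J : ℕ, 1 ≤ J →
      Q J {θ | ¬ ∀ j, θ j ∈ Set.Icc (-(n : ℝ) ^ q) ((n : ℝ) ^ q)} ≤ ofReal (J * exp (-n)) := by
  obtain ⟨C, hC, t, ht, hQ⟩ := hQ
  refine ⟨⌈2 / t⌉₊ + 1, fun q hq => ?_⟩
  have hqt : 2 ≤ q * t := by
    have : 2 / t ≤ q := (Nat.le_ceil _).trans (by norm_cast; omega)
    rwa [div_le_iff₀ ht] at this
  have hpow : Tendsto (fun n : ℕ => (n : ℝ) ^ q) atTop atTop :=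
    (tendsto_pow_atTop (by omega)).comp tendsto_natCast_atTop_atTop
  filter_upwards [hpow.eventually hQ, eventually_ge_atTop 1,
    tendsto_natCast_atTop_atTop.eventually_ge_atTop (1 / C)] with n hn hn1 hnC J hJ
  have hn1' : (1 : ℝ) ≤ n := by exact_mod_cast hn1
  have hexponent : (n : ℝ) ≤ C * ((n : ℝ) ^ q) ^ t :=
    calc (n : ℝ) ≤ C * n * n := by
          rw [div_le_iff₀ hC] at hnC
          nlinarith
      _ = C * (n : ℝ) ^ (2 : ℝ) := by
          rw [Real.rpow_two]
          ring
      _ ≤ C * (n : ℝ) ^ (q * t) := by gcongr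
      _ = C * ((n : ℝ) ^ q) ^ t := by rw [Real.rpow_mul (by positivity), Real.rpow_natCast]
  rw [← ofReal_measureReal]
  refine ENNReal.ofReal_le_ofReal ((hn J hJ).trans ?_)
  gcongr
  linarith

end CoefficientMass

section DimensionPrior

variable {p : PMF ℕ} {t₁ t₂ : ℝ}

lemma DimensionPriorCondition.exists_exp_neg_le (hp : DimensionPriorCondition p t₁ t₂) :
    ∃ c, ∀ᶠ j : ℕ in atTop, ofReal (exp (-(c * (j * log j)))) ≤ p j := by
  obtain ⟨-, -, ht₁, c, hc, c₂, -, hp⟩ := hp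
  refine ⟨c, ?_⟩
  filter_upwards [hp, tendsto_log_natCast.eventually_ge_atTop 1] with j hj hlog
  rw [← ENNReal.ofReal_toReal (p.apply_ne_top j)]
  refine ENNReal.ofReal_le_ofReal (le_trans ?_ hj.1)
  have hrpow : log j ^ t₁ ≤ log j := Real.rpow_le_self_of_one_le hlog ht₁
  rw [neg_mul, neg_mul, mul_assoc]
  gcongr

lemma toMeasure_Ioi_le_of_le_exp {c lam : ℝ} (hc : 0 ≤ c) (hlam : 1 ≤ lam) {N : ℕ}
    (hp : ∀ J > N, p J ≤ ofReal (exp (-(2 * c * J * lam)))) :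
    p.toMeasure (Set.Ioi N) ≤
      (1 - ofReal (exp (-c)))⁻¹ * ofReal (exp (-(c * (N * lam)))) := by
  rw [p.toMeasure_apply measurableSet_Ioi, ← ENNReal.tsum_geometric, ← ENNReal.tsum_mul_right]
  refine ENNReal.tsum_le_tsum fun J => ?_
  by_cases hJ : J ∈ Set.Ioi N
  · rw [Set.indicator_of_mem hJ, ofReal_exp_pow, ← ofReal_exp_add]
    refine (hp J hJ).trans ?_
    have hN : (N : ℝ) ≤ J := by exact_mod_cast (Set.mem_Ioi.1 hJ).le
    gcongr
    have hfirst : c * (N * lam) ≤ c * (J * lam) := by gcongr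
    have hsecond : c * (J * 1) ≤ c * (J * lam) := by gcongr
    linarith
  · rw [Set.indicator_of_notMem hJ]
    exact zero_le

lemma DimensionPriorCondition.exists_toMeasure_Ioi_le (hp : DimensionPriorCondition p t₁ t₂) :
    ∃ c > 0, ∃ K ≠ ∞, ∀ᶠ N : ℕ in atTop,
      p.toMeasure (Set.Ioi N) ≤ K * ofReal (exp (-(c * (N * log N ^ t₂)))) := by
  obtain ⟨ht₂, -, -, c₁, -, c, hc, hp⟩ := hp
  have hK : 1 - ofReal (exp (-(c / 2))) ≠ 0 :=
    (tsub_pos_of_lt (ENNReal.ofReal_lt_one.2 (Real.exp_lt_one_iff.2 (by linarith)))).ne'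
  refine ⟨c / 2, half_pos hc, _, ENNReal.inv_ne_top.2 hK, ?_⟩
  filter_upwards [eventually_forall_ge_atTop.2 hp,
    tendsto_log_natCast.eventually_ge_atTop 1, eventually_gt_atTop 0] with N hN hlog hN0
  refine toMeasure_Ioi_le_of_le_exp (by positivity) (Real.one_le_rpow hlog ht₂) fun J hJ => ?_
  rw [← ENNReal.ofReal_toReal (p.apply_ne_top J)]
  refine ENNReal.ofReal_le_ofReal ((hN J hJ.le).2.trans ?_)
  rw [mul_div_cancel₀ c two_ne_zero, neg_mul, neg_mul]
  gcongr

end DimensionPrior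

section SeriesPrior

variable {m : ℕ} {p : PMF ℕ} {Q : (J : ℕ) → Fin m → Measure (EuclideanSpace ℝ (Fin J))}

lemma seriesPrior_apply (U : Set (SeriesParam m)) :
    seriesPrior p Q U = ∑' J, p J * Measure.pi (Q J) {θ | (⟨J, θ⟩ : SeriesParam m) ∈ U} := by
  simp only [seriesPrior, Measure.sum_apply_of_countable, Measure.smul_apply, smul_eq_mul]
  exact tsum_congr fun J => congrArg _ ((measurableEmbedding_sigmaMk
    (E := fun J => Fin m → EuclideanSpace ℝ (Fin J)) J).map_apply _ _)

variable [∀ J k, IsProbabilityMeasure (Q J k)]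

instance isProbabilityMeasure_seriesPrior : IsProbabilityMeasure (seriesPrior p Q) where
  measure_univ := by simp [seriesPrior_apply]

lemma mul_prod_le_seriesPrior {j : ℕ} {A : Fin m → Set (EuclideanSpace ℝ (Fin j))}
    {U : Set (SeriesParam m)} (hU : ∀ θ ∈ Set.univ.pi A, (⟨j, θ⟩ : SeriesParam m) ∈ U) :
    p j * ∏ k, Q j k (A k) ≤ seriesPrior p Q U := by
  rw [← Measure.pi_pi, seriesPrior_apply]
  exact (mul_le_mul_right (measure_mono fun θ hθ => hU θ hθ) _).trans (ENNReal.le_tsum j)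

lemma exists_exp_neg_le_seriesPrior_supNeighborhood {ψ : (J : ℕ) → Fin J → unitInterval → ℝ}
    {K₀ t₁ t₂ H α : ℝ} {β₀ : Fin m → unitInterval → ℝ} (hp : DimensionPriorCondition p t₁ t₂)
    (hQ : ∀ k, CoefficientMassCondition (fun J => Q J k) H)
    (happrox : ∀ k, ApproximationCondition ψ (β₀ k) H α) (hbasis : BasisLipschitzCondition ψ K₀) :
    ∃ a, ∃ C ≥ 0, ∀ᶠ j : ℕ in atTop, ofReal (exp (-(a * (j * log j)))) ≤
      seriesPrior p Q (supNeighborhood ψ β₀ (C * (j : ℝ) ^ (-α))) := by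
  obtain ⟨a₀, hp⟩ := hp.exists_exp_neg_le
  choose a C hQ using fun k => (hQ k).exists_exp_neg_le_series_ball (happrox k) hbasis
  obtain ⟨D, hD⟩ := Finite.exists_le C
  refine ⟨a₀ + ∑ k, a k, max D 0, le_max_right _ _, ?_⟩
  filter_upwards [hp, eventually_all.2 hQ] with j hpj hQj
  calc ofReal (exp (-((a₀ + ∑ k, a k) * (j * log j))))
      = ofReal (exp (-(a₀ * (j * log j)))) * ∏ k, ofReal (exp (-(a k * (j * log j)))) := by
        rw [← ENNReal.ofReal_prod_of_nonneg fun k _ => (Real.exp_pos _).le, ← Real.exp_sum,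
          Finset.sum_neg_distrib, ← Finset.sum_mul, ← ofReal_exp_add]
        ring_nf
    _ ≤ p j * ∏ k, Q j k {θ | ∀ t, |series (ψ j) θ t - β₀ k t| ≤ C k * (j : ℝ) ^ (-α)} :=
        mul_le_mul' hpj (Finset.prod_le_prod' fun k _ => hQj k)
    _ ≤ seriesPrior p Q (supNeighborhood ψ β₀ (max D 0 * (j : ℝ) ^ (-α))) := by
        refine mul_prod_le_seriesPrior fun θ hθ l t => (hθ l (Set.mem_univ l) t).trans ?_
        gcongr
        exact (hD l).trans (le_max_left D 0)

/-- Parameters with at most `N` basis functions and coefficients in `[-B, B]`. -/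
def sieve (m N : ℕ) (B : ℝ) : Set (SeriesParam m) :=
  {s | s.1 ≤ N ∧ ∀ k j, s.2 k j ∈ Set.Icc (-B) B}

lemma pi_sieve_compl_le {N J : ℕ} {B : ℝ} {e : ℝ≥0∞} (hJ : J ≤ N)
    (hQ : ∀ k, Q J k {θ | ¬ ∀ j, θ j ∈ Set.Icc (-B) B} ≤ e) :
    Measure.pi (Q J) {θ | (⟨J, θ⟩ : SeriesParam m) ∉ sieve m N B} ≤ m * e := by
  have hmeas : MeasurableSet {θ : EuclideanSpace ℝ (Fin J) | ¬ ∀ j, θ j ∈ Set.Icc (-B) B} := by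
    measurability
  have hsub : {θ | (⟨J, θ⟩ : SeriesParam m) ∉ sieve m N B} ⊆
      ⋃ k, Function.eval k ⁻¹' {θ : EuclideanSpace ℝ (Fin J) | ¬ ∀ j, θ j ∈ Set.Icc (-B) B} := by
    intro θ hθ
    by_contra! hcube
    exact hθ ⟨hJ, by simpa using hcube⟩
  calc Measure.pi (Q J) {θ | (⟨J, θ⟩ : SeriesParam m) ∉ sieve m N B}
      ≤ ∑ k, Measure.pi (Q J) (Function.eval k ⁻¹' {θ | ¬ ∀ j, θ j ∈ Set.Icc (-B) B}) :=
        (measure_mono hsub).trans (measure_iUnion_fintype_le _ _)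
    _ ≤ ∑ _k : Fin m, e := Finset.sum_le_sum fun k _ => by
        rw [(measurePreserving_eval (Q J) k).measure_preimage hmeas.nullMeasurableSet]
        exact hQ k
    _ = m * e := by simp

lemma seriesPrior_sieve_compl_le {N : ℕ} {B : ℝ} {e : ℝ≥0∞}
    (hQ : ∀ J, 1 ≤ J → J ≤ N → ∀ k, Q J k {θ | ¬ ∀ j, θ j ∈ Set.Icc (-B) B} ≤ e) :
    seriesPrior p Q (sieve m N B)ᶜ ≤ m * e + p.toMeasure (Set.Ioi N) := by
  have hterm (J : ℕ) : p J * Measure.pi (Q J) {θ | (⟨J, θ⟩ : SeriesParam m) ∉ sieve m N B} ≤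
      p J * (m * e) + (Set.Ioi N).indicator p J := by
    rcases le_or_gt J N with hJ | hJ
    · refine le_add_right (mul_le_mul_right (pi_sieve_compl_le hJ fun k => ?_) _)
      rcases Nat.eq_zero_or_pos J with rfl | hJ0
      · simp
      · exact hQ J hJ0 hJ k
    · rw [Set.indicator_of_mem (Set.mem_Ioi.2 hJ)]
      exact le_add_left (mul_le_of_le_one_right' prob_le_one)
  rw [seriesPrior_apply, p.toMeasure_apply measurableSet_Ioi]
  refine (ENNReal.tsum_le_tsum hterm).trans_eq ?_
  rw [ENNReal.tsum_add, ENNReal.tsum_mul_right, p.tsum_coe, one_mul]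

end SeriesPrior

section Cells

variable {m : ℕ}

/-- The cell, in the grid of mesh size `1 / w`, that contains the coefficients of a parameter. -/
noncomputable def gridCell (w : ℝ) (s : SeriesParam m) : Σ J : ℕ, Fin m → Fin J → ℤ :=
  ⟨s.1, fun k j => ⌊s.2 k j * w⌋⟩

lemma exists_finset_gridCell_mem (N : ℕ) {B w : ℝ} {W : ℕ} (hw : 0 ≤ w) (hW : B * w ≤ W) :
    ∃ F : Finset (Σ J : ℕ, Fin m → Fin J → ℤ), (∀ s ∈ sieve m N B, gridCell w s ∈ F) ∧
      F.card ≤ (N + 1) * (2 * W + 1) ^ (m * N) := by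
  refine ⟨(Finset.range (N + 1)).sigma fun J => Fintype.piFinset fun _ => Fintype.piFinset fun _ =>
    Finset.Icc (-(W : ℤ)) W, fun s hs => ?_, ?_⟩
  · simp only [gridCell, Finset.mem_sigma, Finset.mem_range, Fintype.mem_piFinset, Finset.mem_Icc]
    refine ⟨Nat.lt_succ_of_le hs.1, fun k j => ?_⟩
    have hlower := mul_le_mul_of_nonneg_right (hs.2 k j).1 hw
    have hupper := mul_le_mul_of_nonneg_right (hs.2 k j).2 hw
    constructor
    · rw [Int.le_floor]
      push_cast
      linarith
    · exact Int.floor_le_iff.2 (by push_cast; linarith)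
  · have hcard : ((W : ℤ) + 1 - -W).toNat = 2 * W + 1 := by omega
    calc _ = ∑ J ∈ Finset.range (N + 1), (2 * W + 1) ^ (m * J) := by
          simp only [Finset.card_sigma, Fintype.card_piFinset, Int.card_Icc, hcard,
            Finset.prod_const, Finset.card_univ, Fintype.card_fin, ← pow_mul, mul_comm]
      _ ≤ ∑ _J ∈ Finset.range (N + 1), (2 * W + 1) ^ (m * N) := by
          gcongr with J hJ
          · omega
          · exact Nat.lt_succ_iff.1 (Finset.mem_range.1 hJ)
      _ = (N + 1) * (2 * W + 1) ^ (m * N) := by simp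

lemma norm_le_natCast_mul_of_forall_abs_le {J : ℕ} {r : ℝ} {v : EuclideanSpace ℝ (Fin J)}
    (hv : ∀ j, |v j| ≤ r) : ‖v‖ ≤ J * r := by
  rw [EuclideanSpace.norm_eq]
  have hsum : ∑ j, |v j| ≤ J * r :=
    (Finset.sum_le_sum fun j _ => hv j).trans_eq (by simp)
  have hsq : ∑ j, |v j| ^ 2 ≤ (∑ j, |v j|) ^ 2 :=
    Finset.sum_sq_le_sq_sum_of_nonneg fun j _ => abs_nonneg _
  exact (Real.sqrt_le_left (Finset.sum_nonneg fun j _ => abs_nonneg _)).2 hsq |>.trans hsum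

variable {ψ : (J : ℕ) → Fin J → unitInterval → ℝ} {K₀ : ℝ}

lemma BasisLipschitzCondition.exists_abs_coeff_sub_le_of_gridCell_eq (hK₀ : 0 ≤ K₀)
    (hbasis : BasisLipschitzCondition ψ K₀) :
    ∃ C > 0, ∀ (N : ℕ) (w : ℝ), 0 < w → ∀ s s' : SeriesParam m, s.1 ≤ N →
      gridCell w s = gridCell w s' →
      ∀ l t, |s.coeff ψ l t - s'.coeff ψ l t| ≤ C * (N : ℝ) ^ (K₀ + 1) / w := by
  obtain ⟨C, hC, hbasis⟩ := hbasis
  refine ⟨C, hC, fun N w hw ⟨J, θ⟩ ⟨J', θ'⟩ hJN hcell l t => ?_⟩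
  obtain rfl : J = J' := congrArg Sigma.fst hcell
  have hfloor : (fun k j => ⌊θ k j * w⌋) = fun k j => ⌊θ' k j * w⌋ :=
    eq_of_heq (Sigma.mk.inj hcell).2
  rcases Nat.eq_zero_or_pos J with rfl | hJ
  · simp only [SeriesParam.coeff, series, Finset.univ_eq_empty, Finset.sum_empty, sub_self,
      abs_zero]
    positivity
  have hJ0 : (0 : ℝ) < J := by exact_mod_cast hJ
  have hcoord (j : Fin J) : |(θ l - θ' l) j| ≤ 1 / w := by
    have h := Int.abs_sub_lt_one_of_floor_eq_floor (congrFun (congrFun hfloor l) j)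
    rw [← sub_mul, abs_mul, abs_of_pos hw] at h
    exact (le_div_iff₀ hw).2 h.le
  calc |series (ψ J) (θ l) t - series (ψ J) (θ' l) t|
      ≤ C * (J : ℝ) ^ K₀ * ‖θ l - θ' l‖ := hbasis J hJ _ _ t
    _ ≤ C * (J : ℝ) ^ K₀ * (J * (1 / w)) := by
        gcongr
        exact norm_le_natCast_mul_of_forall_abs_le hcoord
    _ = C * (J : ℝ) ^ (K₀ + 1) / w := by
        rw [Real.rpow_add_one hJ0.ne']
        ring
    _ ≤ C * (N : ℝ) ^ (K₀ + 1) / w := by gcongr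

lemma BasisLipschitzCondition.exists_isSupCover_sieve (hK₀ : 0 ≤ K₀)
    (hbasis : BasisLipschitzCondition ψ K₀) :
    ∃ C > 0, ∀ (N : ℕ) {B w : ℝ} {W : ℕ}, 0 < w → B * w ≤ W →
      ∃ F, IsSupCover ψ (C * (N : ℝ) ^ (K₀ + 1) / w) (sieve m N B) F ∧
        F.card ≤ (N + 1) * (2 * W + 1) ^ (m * N) := by
  classical
  obtain ⟨C, hC, hcell⟩ := hbasis.exists_abs_coeff_sub_le_of_gridCell_eq (m := m) hK₀
  refine ⟨C, hC, fun N B w W hw hW => ?_⟩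
  obtain ⟨F, hF, hcard⟩ := exists_finset_gridCell_mem (m := m) N hw.le hW
  refine ⟨F.image fun c => {s ∈ sieve m N B | gridCell w s = c}, ⟨fun s hs => ?_, ?_⟩,
    Finset.card_image_le.trans hcard⟩
  · exact ⟨_, Finset.mem_image_of_mem _ (hF s hs), hs, rfl⟩
  · rw [Finset.forall_mem_image]
    exact fun c _ s hs s' hs' => hcell N w hw s s' hs.1.1 (hs.2.trans hs'.2.symm)

end Cells

section Scale

/-- The sequence `n^a (log n)^b`; all rates in the contraction argument have this form. -/
noncomputable def powLogScale (a b : ℝ) (n : ℕ) : ℝ :=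
  (n : ℝ) ^ a * log n ^ b

/-- The numbers of basis functions of order `n^a (log n)^b`, with leading constant `L`. -/
noncomputable def powLogDim (L a b : ℝ) (n : ℕ) : ℕ :=
  ⌈L * powLogScale a b n⌉₊

variable {L a b a' b' : ℝ} {n : ℕ}

lemma powLogScale_nonneg : 0 ≤ powLogScale a b n :=
  mul_nonneg (by positivity) (Real.rpow_nonneg (Real.log_natCast_nonneg n) b)

lemma powLogScale_mul (hn : 1 < n) :
    powLogScale a b n * powLogScale a' b' n = powLogScale (a + a') (b + b') n := by
  have hlog : 0 < log n := Real.log_pos (by exact_mod_cast hn)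
  rw [powLogScale, powLogScale, powLogScale, Real.rpow_add (by positivity), Real.rpow_add hlog]
  ring

lemma powLogScale_rpow (r : ℝ) : powLogScale a b n ^ r = powLogScale (a * r) (b * r) n := by
  have hlog := Real.log_natCast_nonneg n
  rw [powLogScale, powLogScale, Real.mul_rpow (by positivity) (by positivity),
    ← Real.rpow_mul n.cast_nonneg, ← Real.rpow_mul hlog]

lemma natCast_eq_powLogScale : (n : ℝ) = powLogScale 1 0 n := by simp [powLogScale]

lemma log_eq_powLogScale : log n = powLogScale 0 1 n := by simp [powLogScale]

lemma powLogScale_isLittleO (h : a < a') : powLogScale a b =o[atTop] powLogScale a' b' := by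
  have hlog : powLogScale 0 (b - b') =o[atTop] powLogScale (a' - a) 0 := by
    unfold powLogScale
    simpa [Function.comp_def] using (isLittleO_log_rpow_rpow_atTop (b - b')
      (sub_pos.2 h)).comp_tendsto (tendsto_natCast_atTop_atTop (R := ℝ))
  refine ((Asymptotics.isBigO_refl (powLogScale a b') atTop).mul_isLittleO hlog).congr' ?_ ?_ <;>
  · filter_upwards [eventually_gt_atTop 1] with n hn
    rw [powLogScale_mul hn]
    ring_nf

lemma powLogScale_isBigO (h : b ≤ b') : powLogScale a b =O[atTop] powLogScale a b' := by
  refine Asymptotics.IsBigO.of_norm_eventuallyLE ?_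
  filter_upwards [tendsto_log_natCast.eventually_ge_atTop 1] with n hlog
  rw [Real.norm_of_nonneg powLogScale_nonneg, powLogScale, powLogScale]
  gcongr

lemma tendsto_powLogScale (ha : 0 < a) : Tendsto (powLogScale a b) atTop atTop := by
  have h : (fun _ => (1 : ℝ)) =o[atTop] powLogScale a b := by
    refine (powLogScale_isLittleO (b := 0) ha).congr_left fun n => ?_
    simp [powLogScale]
  exact (Asymptotics.isLittleO_one_left_iff ℝ).1 h |>.congr fun n =>
    Real.norm_of_nonneg powLogScale_nonneg

lemma eventually_powLogScale_le (hL : 0 < L) (h : a < a') :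
    ∀ᶠ n : ℕ in atTop, powLogScale a b n ≤ L * powLogScale a' b' n := by
  filter_upwards [(powLogScale_isLittleO h).bound hL] with n hn
  rwa [Real.norm_of_nonneg powLogScale_nonneg, Real.norm_of_nonneg powLogScale_nonneg] at hn

lemma le_powLogDim : L * powLogScale a b n ≤ powLogDim L a b n := Nat.le_ceil _

lemma tendsto_powLogDim (hL : 0 < L) (ha : 0 < a) : Tendsto (powLogDim L a b) atTop atTop :=
  tendsto_nat_ceil_atTop.comp ((tendsto_powLogScale ha).const_mul_atTop hL)

lemma eventually_powLogDim_le (hL : 0 < L) (ha : 0 < a) :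
    ∀ᶠ n : ℕ in atTop, (powLogDim L a b n : ℝ) ≤ 2 * (L * powLogScale a b n) := by
  filter_upwards [((tendsto_powLogScale ha).const_mul_atTop hL).eventually_ge_atTop 2⁻¹] with n hn
  exact Nat.ceil_le_two_mul hn

lemma eventually_powLogDim_le_self (hL : 0 < L) (ha : a < 1) :
    ∀ᶠ n : ℕ in atTop, powLogDim L a b n ≤ n := by
  filter_upwards [eventually_powLogScale_le (inv_pos.2 hL) ha] with n hn
  rw [← natCast_eq_powLogScale, ← div_eq_inv_mul, le_div_iff₀' hL] at hn
  exact Nat.ceil_le.2 hn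

lemma eventually_mul_log_le_log_powLogDim (hL : 0 < L) (ha : 0 < a) :
    ∀ᶠ n : ℕ in atTop, a / 2 * log n ≤ log (powLogDim L a b n) := by
  filter_upwards [eventually_powLogScale_le (b := 0) (b' := b) hL (half_lt_self ha),
    eventually_gt_atTop 0] with n hn hn0
  have hn0' : (0 : ℝ) < n := by exact_mod_cast hn0
  rw [powLogScale, Real.rpow_zero, mul_one] at hn
  rw [← Real.log_rpow hn0']
  exact Real.log_le_log (by positivity) (hn.trans le_powLogDim)

lemma eventually_powLogDim_mul_log_le (hL : 0 < L) (ha : 0 < a) :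
    ∀ᶠ n : ℕ in atTop, (powLogDim L a b n : ℝ) * log n ≤ 2 * (L * powLogScale a (b + 1) n) := by
  filter_upwards [eventually_powLogDim_le (b := b) hL ha, eventually_gt_atTop 1] with n hdim hn
  calc (powLogDim L a b n : ℝ) * log n ≤ 2 * (L * powLogScale a b n) * log n :=
        mul_le_mul_of_nonneg_right hdim (Real.log_natCast_nonneg n)
    _ = 2 * (L * powLogScale a (b + 1) n) := by
        rw [log_eq_powLogScale, mul_assoc, mul_assoc, powLogScale_mul hn, add_zero]

lemma eventually_le_powLogDim_mul_log_rpow (hL : 0 < L) (ha : 0 < a) {t : ℝ} (ht : 0 ≤ t) :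
    ∀ᶠ n : ℕ in atTop, L * (a / 2) ^ t * powLogScale a (b + t) n ≤
      powLogDim L a b n * log (powLogDim L a b n) ^ t := by
  filter_upwards [eventually_mul_log_le_log_powLogDim (b := b) hL ha, eventually_gt_atTop 1]
    with n hlog hn
  have hlog0 := Real.log_natCast_nonneg n
  calc L * (a / 2) ^ t * powLogScale a (b + t) n
      = L * powLogScale a b n * (a / 2 * log n) ^ t := by
        rw [Real.mul_rpow (by positivity) hlog0, log_eq_powLogScale, powLogScale_rpow, zero_mul,
          one_mul, ← add_zero a, ← powLogScale_mul hn, add_zero]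
        ring
    _ ≤ powLogDim L a b n * log (powLogDim L a b n) ^ t :=
        mul_le_mul le_powLogDim (Real.rpow_le_rpow (by positivity) hlog ht) (by positivity)
          (Nat.cast_nonneg _)

lemma natCast_mul_powLogScale_sq (hn : 1 < n) :
    n * powLogScale a b n ^ 2 = powLogScale (1 + 2 * a) (2 * b) n := by
  rw [← Real.rpow_two, powLogScale_rpow, natCast_eq_powLogScale, powLogScale_mul hn]
  ring_nf

lemma powLogDim_one_rpow_neg_le {α : ℝ} (hn : 1 < n) (hα : 0 ≤ α) :
    (powLogDim 1 a b n : ℝ) ^ (-α) ≤ powLogScale (-(a * α)) (-(b * α)) n := by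
  have hlog : 0 < log n := Real.log_pos (by exact_mod_cast hn)
  have hpos : 0 < powLogScale a b n := by
    unfold powLogScale
    positivity
  rw [neg_mul_eq_mul_neg, neg_mul_eq_mul_neg, ← powLogScale_rpow]
  exact Real.rpow_le_rpow_of_nonpos hpos (one_mul (powLogScale a b n) ▸ le_powLogDim)
    (neg_nonpos.2 hα)

lemma tendsto_powLogScale_of_neg (ha : a < 0) :
    Tendsto (powLogScale a b) atTop (𝓝 0) := by
  refine (Asymptotics.isLittleO_one_iff ℝ).1 ((powLogScale_isLittleO (b' := 0) ha).congr_right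
    fun n => ?_)
  simp [powLogScale]

lemma powLogScale_isBigO_natCast_mul_sq {ε : ℕ → ℝ} (h : powLogScale a b =O[atTop] ε) :
    powLogScale (1 + 2 * a) (2 * b) =O[atTop] fun n : ℕ => n * ε n ^ 2 := by
  refine ((Asymptotics.isBigO_refl (fun n : ℕ => (n : ℝ)) atTop).mul (h.pow 2)).congr' ?_ .rfl
  filter_upwards [eventually_gt_atTop 1] with n hn
  exact natCast_mul_powLogScale_sq hn

lemma natCast_mul_const_mul_powLogScale_sq_isBigO (C a b : ℝ) :
    (fun n : ℕ => n * (C * powLogScale a b n) ^ 2) =O[atTop] powLogScale (1 + 2 * a) (2 * b) := by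
  refine ((Asymptotics.isBigO_refl _ atTop).const_mul_left (C ^ 2)).congr' ?_ .rfl
  filter_upwards [eventually_gt_atTop 1] with n hn
  rw [mul_pow, mul_left_comm, natCast_mul_powLogScale_sq hn]

end Scale

section SieveAsymptotics

variable {m : ℕ} {p : PMF ℕ} {Q : (J : ℕ) → Fin m → Measure (EuclideanSpace ℝ (Fin J))}
  {t₁ t₂ : ℝ}

lemma CoefficientTailCondition.exists_pow_tail_le_forall {ι : Type*} [Finite ι]
    {Q : (J : ℕ) → ι → Measure (EuclideanSpace ℝ (Fin J))} [∀ J k, IsFiniteMeasure (Q J k)]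
    (hQ : ∀ k, CoefficientTailCondition fun J => Q J k) :
    ∃ q : ℕ, ∀ᶠ n : ℕ in atTop, ∀ k, ∀ J : ℕ, 1 ≤ J →
      Q J k {θ | ¬ ∀ j, θ j ∈ Set.Icc (-(n : ℝ) ^ q) ((n : ℝ) ^ q)} ≤ ofReal (J * exp (-n)) := by
  choose q₀ hq₀ using fun k => (hQ k).exists_pow_tail_le
  obtain ⟨q, hq⟩ := Finite.exists_le q₀
  exact ⟨q, eventually_all.2 fun k => hq₀ k q (hq k)⟩

lemma exists_seriesPrior_sieve_compl_le [∀ J k, IsProbabilityMeasure (Q J k)]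
    (hp : DimensionPriorCondition p t₁ t₂) (hQ : ∀ k, CoefficientTailCondition fun J => Q J k) :
    ∃ q : ℕ, ∃ c > 0, ∃ K ≠ ∞, ∀ N : ℕ → ℕ, Tendsto N atTop atTop → (∀ᶠ n in atTop, N n ≤ n) →
      ∀ᶠ n : ℕ in atTop, seriesPrior p Q (sieve m (N n) ((n : ℝ) ^ q))ᶜ ≤
        m * ofReal (n * exp (-n)) + K * ofReal (exp (-(c * (N n * log (N n) ^ t₂)))) := by
  obtain ⟨q, hq⟩ := CoefficientTailCondition.exists_pow_tail_le_forall hQ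
  obtain ⟨c, hc, K, hK, hdim⟩ := hp.exists_toMeasure_Ioi_le
  refine ⟨q, c, hc, K, hK, fun N hN hNn => ?_⟩
  filter_upwards [hq, hNn, hN.eventually hdim] with n hqn hNn hdim
  refine (seriesPrior_sieve_compl_le fun J hJ hJN k => (hqn k J hJ).trans ?_).trans
    (add_le_add_right hdim _)
  gcongr
  exact hJN.trans hNn

lemma tendsto_exp_mul_ofReal_mul_exp_neg {f : ℕ → ℝ} (hf : f =o[atTop] fun n : ℕ => (n : ℝ)) :
    Tendsto (fun n : ℕ => ofReal (exp (f n)) * ofReal (n * exp (-n))) atTop (𝓝 0) := by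
  have hlog : (fun n : ℕ => log n) =o[atTop] fun n : ℕ => (n : ℝ) :=
    Real.isLittleO_log_id_atTop.comp_tendsto tendsto_natCast_atTop_atTop
  have hsmall : (fun n : ℕ => f n + log n) =o[atTop] fun n : ℕ => (-n : ℝ) :=
    (hf.add hlog).neg_right
  have hexponent : Tendsto (fun n : ℕ => f n + log n + -n) atTop atBot :=
    (hsmall.add_isEquivalent .refl).symm.tendsto_atBot
      (tendsto_neg_atTop_atBot.comp tendsto_natCast_atTop_atTop)
  refine (tendsto_ofReal_exp_zero hexponent).congr' ?_
  filter_upwards [eventually_gt_atTop 0] with n hn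
  have hn0 : (0 : ℝ) < n := by exact_mod_cast hn
  rw [← ENNReal.ofReal_mul (Real.exp_pos _).le, Real.exp_add, Real.exp_add, Real.exp_log hn0,
    mul_assoc]

lemma exists_tendsto_exp_mul_seriesPrior_sieve_compl [∀ J k, IsProbabilityMeasure (Q J k)]
    {a b : ℝ} (ha : 0 < a) (ha1 : a < 1) (hp : DimensionPriorCondition p t₁ t₂)
    (hQ : ∀ k, CoefficientTailCondition fun J => Q J k) :
    ∃ q : ℕ, ∀ c, ∃ L > 0, Tendsto (fun n : ℕ => ofReal (exp (c * powLogScale a b n)) *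
      seriesPrior p Q (sieve m (powLogDim L a (b - t₂) n) ((n : ℝ) ^ q))ᶜ) atTop (𝓝 0) := by
  obtain ⟨q, c₂, hc₂, K, hK, hsieve⟩ := exists_seriesPrior_sieve_compl_le hp hQ
  refine ⟨q, fun c => ?_⟩
  set T := powLogScale a b
  -- With this `L`, the dimension `N` of the sieve satisfies `c₂ N (log N)^t₂ ≥ (|c| + 1) T`.
  obtain ⟨L, hL, hLc⟩ : ∃ L > 0, c₂ * (L * (a / 2) ^ t₂) = |c| + 1 :=
    ⟨(|c| + 1) / (c₂ * (a / 2) ^ t₂), by positivity, by field_simp⟩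
  refine ⟨L, hL, ?_⟩
  have hT : T =o[atTop] fun n : ℕ => (n : ℝ) :=
    (powLogScale_isLittleO ha1).congr_right fun _ => natCast_eq_powLogScale.symm
  have hcube := ENNReal.Tendsto.const_mul (a := (m : ℝ≥0∞))
    (tendsto_exp_mul_ofReal_mul_exp_neg (hT.const_mul_left c)) (.inr (ENNReal.natCast_ne_top m))
  have hdim := ENNReal.Tendsto.const_mul (a := K)
    (tendsto_ofReal_exp_zero (tendsto_neg_atTop_atBot.comp
      (tendsto_powLogScale (b := b) ha))) (.inr hK)
  have hsum := hcube.add hdim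
  simp only [mul_zero, add_zero] at hsum
  refine tendsto_of_tendsto_of_tendsto_of_le_of_le' tendsto_const_nhds hsum
    (.of_forall fun _ => zero_le) ?_
  filter_upwards [hsieve _ (tendsto_powLogDim hL ha) (eventually_powLogDim_le_self hL ha1),
    eventually_le_powLogDim_mul_log_rpow hL ha hp.1] with n hn hNn
  refine (mul_le_mul_right hn _).trans ?_
  rw [mul_add, mul_left_comm, mul_left_comm _ K, ← ofReal_exp_add]
  gcongr
  have hcT : c * T n ≤ |c| * T n := by gcongr; exacts [powLogScale_nonneg, le_abs_self c]
  rw [sub_add_cancel] at hNn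
  have hdecay := mul_le_mul_of_nonneg_left hNn hc₂.le
  rw [← mul_assoc, hLc] at hdecay
  simp only [Function.comp_apply]
  linarith only [hdecay, hcT]

lemma natCast_mul_pow_le_exp {m N W n d : ℕ} (hn : 3 ≤ n) (hW : W ≤ n ^ d) :
    (((N + 1) * (2 * W + 1) ^ (m * N) : ℕ) : ℝ) ≤
      exp ((1 + m * (d + 1)) * ((N + 1) * log n)) := by
  have hn0 : (0 : ℝ) < n := by positivity
  have hlog : 1 ≤ log n := by
    rw [Real.le_log_iff_exp_le hn0]
    exact Real.exp_one_lt_three.le.trans (by exact_mod_cast hn)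
  have hdim : (N : ℝ) + 1 ≤ exp ((N + 1) * log n) :=
    calc (N : ℝ) + 1 ≤ (N + 1) * log n := le_mul_of_one_le_right (by positivity) hlog
      _ ≤ exp ((N + 1) * log n) := (by linarith [Real.add_one_le_exp ((N + 1) * log n)])
  have hgrid : (2 * W + 1 : ℝ) ≤ exp ((d + 1) * log n) :=
    calc (2 * W + 1 : ℝ) ≤ n ^ (d + 1) := by
          have : 2 * W + 1 ≤ n ^ (d + 1) := by
            have : 0 < n ^ d := by positivity
            rw [pow_succ]
            nlinarith
          exact_mod_cast this
      _ = exp ((d + 1) * log n) := by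
          rw [mul_comm, Real.exp_mul, Real.exp_log hn0]
          exact_mod_cast rfl
  push_cast
  calc ((N : ℝ) + 1) * (2 * W + 1) ^ (m * N)
      ≤ exp ((N + 1) * log n) * exp ((d + 1) * log n) ^ (m * N) := by gcongr
    _ = exp ((N + 1) * log n + m * N * ((d + 1) * log n)) := by
        rw [← Real.exp_nat_mul, ← Real.exp_add, Nat.cast_mul]
    _ ≤ exp ((1 + m * (d + 1)) * ((N + 1) * log n)) := by
        rw [Real.exp_le_exp]
        have : 0 ≤ m * (d + 1) * log n := by positivity
        linarith

variable {ψ : (J : ℕ) → Fin J → unitInterval → ℝ} {K₀ : ℝ}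

lemma BasisLipschitzCondition.eventually_exists_isSupCover_sieve
    (hbasis : BasisLipschitzCondition ψ K₀) (q : ℕ) {N : ℕ → ℕ} (hN : ∀ᶠ n in atTop, N n ≤ n) :
    ∃ c ≥ 0, ∀ᶠ n : ℕ in atTop, ∃ F,
      IsSupCover ψ (1 / (n : ℝ) ^ 2) (sieve m (N n) ((n : ℝ) ^ q)) F ∧
        (F.card : ℝ) ≤ exp (c * ((N n + 1) * log n)) := by
  obtain ⟨k, hk⟩ := exists_nat_ge (max K₀ 0)
  obtain ⟨C, -, hcover⟩ := (hbasis.mono ((le_max_left K₀ 0).trans hk)).exists_isSupCover_sieve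
    (m := m) (Nat.cast_nonneg k)
  refine ⟨1 + m * ((q + (k + 4) : ℕ) + 1), by positivity, ?_⟩
  filter_upwards [hN, eventually_ge_atTop 3,
    tendsto_natCast_atTop_atTop.eventually_ge_atTop C] with n hNn hn hCn
  have hn0 : (0 : ℝ) < n := by positivity
  obtain ⟨F, hF, hcard⟩ := hcover (N n) (B := (n : ℝ) ^ q) (w := (n : ℝ) ^ (k + 4))
    (W := n ^ (q + (k + 4))) (by positivity) (by rw [← pow_add]; push_cast; rfl)
  refine ⟨F, hF.mono ?_, (Nat.cast_le.2 hcard).trans (natCast_mul_pow_le_exp hn le_rfl)⟩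
  calc C * (N n : ℝ) ^ ((k : ℝ) + 1) / (n : ℝ) ^ (k + 4)
      ≤ n * (n : ℝ) ^ ((k : ℝ) + 1) / (n : ℝ) ^ (k + 4) := by gcongr
    _ = 1 / (n : ℝ) ^ 2 := by
        rw [Real.rpow_add_one hn0.ne', Real.rpow_natCast]
        field_simp
        ring

lemma BasisLipschitzCondition.eventually_exists_isSupCover_sieve_powLogDim
    (hbasis : BasisLipschitzCondition ψ K₀) (q : ℕ) {L a b : ℝ} (hL : 0 < L) (ha : 0 < a)
    (ha1 : a < 1) :
    ∃ c ≥ 0, ∀ᶠ n : ℕ in atTop, ∃ F,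
      IsSupCover ψ (1 / (n : ℝ) ^ 2) (sieve m (powLogDim L a b n) ((n : ℝ) ^ q)) F ∧
        (F.card : ℝ) ≤ exp (c * powLogScale a (b + 1) n) := by
  obtain ⟨c, hc, h⟩ := hbasis.eventually_exists_isSupCover_sieve (m := m) q
    (eventually_powLogDim_le_self (b := b) hL ha1)
  refine ⟨c * (4 * L), by positivity, ?_⟩
  filter_upwards [h, eventually_powLogDim_mul_log_le (b := b) hL ha,
    (tendsto_powLogDim (b := b) hL ha).eventually_ge_atTop 1] with n ⟨F, hF, hcard⟩ hdim hN
  refine ⟨F, hF, hcard.trans ?_⟩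
  have hN1 : (1 : ℝ) ≤ powLogDim L a b n := by exact_mod_cast hN
  have hentropy : ((powLogDim L a b n : ℝ) + 1) * log n ≤ 4 * L * powLogScale a (b + 1) n :=
    calc ((powLogDim L a b n : ℝ) + 1) * log n
        ≤ (2 * powLogDim L a b n) * log n :=
          mul_le_mul_of_nonneg_right (by linarith) (Real.log_natCast_nonneg n)
      _ ≤ 4 * L * powLogScale a (b + 1) n := by linarith
  rw [mul_assoc c]
  gcongr

end SieveAsymptotics

section Rate

variable {m : ℕ} {p : PMF ℕ} {Q : (J : ℕ) → Fin m → Measure (EuclideanSpace ℝ (Fin J))}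
  [∀ J k, IsProbabilityMeasure (Q J k)] {ψ : (J : ℕ) → Fin J → unitInterval → ℝ}
  {β₀ : Fin m → unitInterval → ℝ} {t₁ t₂ H α K₀ : ℝ}

lemma exists_exp_neg_le_seriesPrior_supNeighborhood_powLogScale {a b : ℝ} (ha : 0 < a)
    (ha1 : a < 1) (hα : 0 ≤ α) (hp : DimensionPriorCondition p t₁ t₂)
    (hQ : ∀ k, CoefficientMassCondition (fun J => Q J k) H)
    (happrox : ∀ k, ApproximationCondition ψ (β₀ k) H α) (hbasis : BasisLipschitzCondition ψ K₀) :
    ∃ c, ∃ C ≥ 0, ∀ᶠ n : ℕ in atTop, ofReal (exp (-(c * powLogScale a (b + 1) n))) ≤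
      seriesPrior p Q (supNeighborhood ψ β₀ (C * powLogScale (-(a * α)) (-(b * α)) n)) := by
  obtain ⟨c, C, hC, hmass⟩ := exists_exp_neg_le_seriesPrior_supNeighborhood hp hQ happrox hbasis
  refine ⟨|c| * 2, C, hC, ?_⟩
  filter_upwards [(tendsto_powLogDim one_pos ha).eventually hmass,
    eventually_powLogDim_mul_log_le (b := b) one_pos ha,
    eventually_powLogDim_le_self (b := b) one_pos ha1,
    (tendsto_powLogDim (b := b) one_pos ha).eventually_gt_atTop 0, eventually_gt_atTop 1]
    with n hmass hdim hle hpos hn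
  set j := powLogDim 1 a b n
  have hcost : c * (j * log j) ≤ |c| * 2 * powLogScale a (b + 1) n :=
    calc c * (j * log j) ≤ |c| * (j * log n) := by
          gcongr
          exact le_abs_self c
      _ ≤ |c| * 2 * powLogScale a (b + 1) n := by
          rw [mul_assoc]
          exact mul_le_mul_of_nonneg_left (by simpa using hdim) (abs_nonneg c)
  calc ofReal (exp (-(|c| * 2 * powLogScale a (b + 1) n)))
      ≤ ofReal (exp (-(c * (j * log j)))) := by gcongr
    _ ≤ seriesPrior p Q (supNeighborhood ψ β₀ (C * (j : ℝ) ^ (-α))) := hmass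
    _ ≤ seriesPrior p Q (supNeighborhood ψ β₀ (C * powLogScale (-(a * α)) (-(b * α)) n)) :=
        measure_mono <| supNeighborhood_mono <|
          mul_le_mul_of_nonneg_left (powLogDim_one_rpow_neg_le hn hα) hC

lemma exists_sieve_tendsto_and_isSupCover {ε : ℕ → ℝ} {a b : ℝ} (ha : 0 < a) (ha1 : a < 1)
    (hp : DimensionPriorCondition p t₁ t₂) (hQ : ∀ k, CoefficientTailCondition fun J => Q J k)
    (hbasis : BasisLipschitzCondition ψ K₀)
    (hε : powLogScale a (b - t₂ + 1) =O[atTop] fun n : ℕ => n * ε n ^ 2) (c : ℝ) :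
    ∃ V : ℕ → Set (SeriesParam m),
      Tendsto (fun n => ofReal (exp (c * powLogScale a b n)) * seriesPrior p Q (V n)ᶜ)
        atTop (𝓝 0) ∧
      ∃ d, ∀ᶠ n : ℕ in atTop, ∃ F, IsSupCover ψ (1 / (n : ℝ) ^ 2) (V n) F ∧
        (F.card : ℝ) ≤ exp (d * (n * ε n ^ 2)) := by
  obtain ⟨q, hq⟩ := exists_tendsto_exp_mul_seriesPrior_sieve_compl ha ha1 hp hQ (b := b)
  obtain ⟨L, hL, htail⟩ := hq c
  refine ⟨_, htail, ?_⟩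
  obtain ⟨d, hd, hcover⟩ := hbasis.eventually_exists_isSupCover_sieve_powLogDim (m := m)
    (b := b - t₂) q hL ha ha1
  obtain ⟨D, hD⟩ := hε.bound
  refine ⟨d * D, ?_⟩
  filter_upwards [hcover, hD] with n ⟨F, hF, hcard⟩ hD
  rw [Real.norm_of_nonneg powLogScale_nonneg, Real.norm_of_nonneg (by positivity)] at hD
  refine ⟨F, hF, hcard.trans ?_⟩
  rw [mul_assoc]
  gcongr

end Rate

theorem theorem4_general {m : ℕ} (G : Measure Covariate) [IsProbabilityMeasure G]
    (hG : ∃ R : ℝ, ∀ᵐ x ∂G, ‖x‖ ≤ R) (ψ : (J : ℕ) → Fin J → unitInterval → ℝ)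
    (hψ : ∀ J j, Measurable (ψ J j)) (β₀ : Fin m → unitInterval → ℝ) (p : PMF ℕ)
    (Q : (J : ℕ) → Fin m → Measure (EuclideanSpace ℝ (Fin J)))
    [∀ J k, IsProbabilityMeasure (Q J k)] (t₁ t₂ H α K₀ : ℝ) (hα : 0 < α)
    (hp : DimensionPriorCondition p t₁ t₂)
    (hmass : ∀ k, CoefficientMassCondition (fun J => Q J k) H)
    (htail : ∀ k, CoefficientTailCondition fun J => Q J k)
    (happrox : ∀ k, ApproximationCondition ψ (β₀ k) H α) (hbasis : BasisLipschitzCondition ψ K₀)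
    (ε : ℕ → ℝ) (hε : ∀ n, 0 < ε n)
    (hrate : (fun n : ℕ => (n : ℝ) ^ (-(α / (2 * α + 1))) *
      log n ^ (α / (2 * α + 1) + (1 - t₂) / 2)) =O[atTop] ε) :
    PosteriorContractsAtRate G ψ (seriesPrior p Q) β₀ ε := by
  set r := α / (2 * α + 1) with hr
  have hr0 : 0 < r := by positivity
  have hr1 : 0 < 1 - 2 * r := by
    rw [hr, sub_pos, ← mul_div_assoc, div_lt_one (by positivity)]
    linarith
  have hrα : (1 - 2 * r) * α = r := by
    rw [hr]
    field_simp
    ring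
  have hψ' := hbasis.boundedMeasurable hψ
  have hentropy : powLogScale (1 - 2 * r) (2 * r - t₂ + 1) =O[atTop] fun n : ℕ => n * ε n ^ 2 := by
    convert powLogScale_isBigO_natCast_mul_sq hrate using 2 <;> ring
  obtain ⟨a, C, hC, hprior⟩ := exists_exp_neg_le_seriesPrior_supNeighborhood_powLogScale
    (b := 2 * r - 1) hr1 (by linarith) hα.le hp hmass happrox hbasis
  rw [sub_add_cancel, hrα, ← neg_mul, neg_sub, hrα] at hprior
  have hδ : Tendsto (fun n => C * powLogScale (-r) r n) atTop (𝓝 0) := by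
    simpa using (tendsto_powLogScale_of_neg (neg_neg_of_pos hr0)).const_mul C
  have hδT : (fun n : ℕ => n * (C * powLogScale (-r) r n) ^ 2) =O[atTop]
      powLogScale (1 - 2 * r) (2 * r) := by
    simpa only [sub_eq_add_neg, mul_neg] using natCast_mul_const_mul_powLogScale_sq_isBigO C (-r) r
  have hη : Tendsto (fun n : ℕ => n * (1 / (n : ℝ) ^ 2)) atTop (𝓝 0) :=
    tendsto_inv_atTop_nhds_zero_nat.congr fun n => by field_simp
  exact posteriorContractsAtRate_of_prior_mass_of_sieve hG hψ'
    (fun l => (happrox l).boundedMeasurable hα hψ') hε (tendsto_powLogScale hr1)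
    ((powLogScale_isBigO (by linarith [hp.2.1, hp.2.2.1])).trans hentropy)
    (fun n => mul_nonneg hC powLogScale_nonneg) hδ hδT ⟨a, hprior⟩ (fun n => by positivity) hη
    (exists_sieve_tendsto_and_isSupCover hr1 (by linarith) hp htail hbasis hentropy)

theorem theorem4 {m : ℕ}
    (G : Measure Covariate) [IsProbabilityMeasure G]
    (hG : ∃ R : ℝ, ∀ᵐ x ∂G, ‖x‖ ≤ R)
    (ψ : (J : ℕ) → Fin J → unitInterval → ℝ) (hψ : ∀ J j, Measurable (ψ J j))
    (β₀ : Fin m → unitInterval → ℝ)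
    (p : PMF ℕ) (Q : (J : ℕ) → Fin m → Measure (EuclideanSpace ℝ (Fin J)))
    [∀ J k, IsProbabilityMeasure (Q J k)]
    (t₁ t₂ H α K₀ : ℝ) (hα : 0 < α) (hK₀ : 0 ≤ K₀)
    (hp : DimensionPriorCondition p t₁ t₂)
    (hQ : ∀ k, CoefficientPriorCondition (fun J => Q J k) H)
    (happrox : ∀ k, ApproximationCondition ψ (β₀ k) H α)
    (hbasis : BasisLipschitzCondition ψ K₀)
    (ε : ℕ → ℝ) (hε : ∀ n, 0 < ε n)
    (hrate : ε =Θ[atTop] fun n : ℕ =>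
      (n : ℝ) ^ (-(α / (2 * α + 1))) *
        Real.log n ^ (α / (2 * α + 1) + (1 - t₂) / 2)) :
    PosteriorContractsAtRate G ψ (seriesPrior p Q) β₀ ε := by
  refine theorem4_general G hG ψ hψ β₀ p Q t₁ t₂ H α K₀ hα hp (fun k => (hQ k).1) (fun k => ?_)
    happrox hbasis ε hε hrate.2
  obtain ⟨-, C, hC, t, ht, h⟩ := hQ k
  exact ⟨C, hC, t, by exact_mod_cast ht, by simpa only [Real.rpow_natCast] using h⟩
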